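/- For a compactly supported probability measure $\mu$ on $\mathbb R$ whose support has left and right edges $a$ and $r(\mu)$, let $G_\mu(z)=\int\frac{d\mu(t)}{z-t}$ be its Stieltjes transform, $K_\mu$ the inverse of the injective map $G_\mu:\mathbb R\setminus[a,r(\mu)]\to\mathbb R$ (extended by continuity by the value $r(\mu)$ at $G_\mu(r(\mu)^+)$ when that limit is finite), and $R_\mu(z)=K_\mu(z)-1/z$ its $R$-transform (extended by continuity at $z=0$). For $b\in\{1,2\}$, $\theta\ge 0$ and $\lambda\ge r(\mu)$ put $H_{\max}(\mu,\lambda)=\lim_{z\downarrow\lambda}G_\mu(z)\in(0,+\infty]$, $$v(\theta,\mu,\lambda)=\begin{cases}R_\mu(\tfrac{2\theta}{b}),&\tfrac{2\theta}{b}\le H_{\max}(\mu,\lambda),\\ \lambda-\tfrac{b}{2\theta},&\tfrac{2\theta}{b}>H_{\max}(\mu,\lambda),\end{cases}$$ $$J_b(\mu,\theta,\lambda)=\theta\, v(\theta,\mu,\lambda)-\frac b2\int\log\Big(1+\frac{2}{b}\theta\, v(\theta,\mu,\lambda)-\frac2b\theta y\Big)d\mu(y).$$ Let $\alpha\ge 1$.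 Let $\sigma_1=\sigma_2$ be the semicircle law $\frac1{2\pi}\sqrt{4-x^2}\,\mathbf 1_{[-2,2]}(x)\,dx$; with $a_\alpha=(1-\sqrt\alpha)^2$, $b_\alpha=(1+\sqrt\alpha)^2$ and $\pi_\alpha(dx)=\frac{\sqrt{(b_\alpha-x)(x-a_\alpha)}}{2\pi x}\mathbf 1_{[a_\alpha,b_\alpha]}(x)\,dx$, let $\sigma_{w_1}=\sigma_{w_2}=\sigma_w$ be given by $$\int f\,d\sigma_w=\frac1{1+\alpha}\Big(\int f\big(\sqrt{\tfrac{x}{1+\alpha}}\big)d\pi_\alpha(x)+\int f\big(-\sqrt{\tfrac{x}{1+\alpha}}\big)d\pi_\alpha(x)\Big)+\frac{\alpha-1}{\alpha+1}f(0).$$ For $b=1,2$ set $F(\theta,b)=\theta^2/b$ and, with $\ln 0=-\infty$, $$F(\theta,w_b)=\sup_{x\in[0,1]}\Big\{\frac{2\theta^2}{b}x(1-x)+\frac{b}{2(1+\alpha)}\ln(1-x)+\frac{b\alpha}{2(1+\alpha)}\ln x\Big\}-b\,C_\alpha,$$ $$C_\alpha=\frac1{2(1+\alpha)}\ln\frac1{1+\alpha}+\frac{\alpha}{2(1+\alpha)}\ln\frac{\alpha}{1+\alpha}.$$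 Let $I_b$ be $+\infty$ on $(-\infty,2)$ and $I_b(x)=\frac b2\int_2^x\sqrt{y^2-4}\,dy$ for $x\ge 2$. Let $\tilde b_\alpha=\sqrt{b_\alpha/(1+\alpha)}$, and let $I_{w_b}$ be $+\infty$ on $(-\infty,\tilde b_\alpha)$ and $$I_{w_b}(x)=\frac{b}{1+\alpha}\int_{\tilde b_\alpha}^x\frac1y\sqrt{(1+\alpha)^2(y^2-1)^2-4\alpha}\,dy\qquad (x\ge\tilde b_\alpha).$$ Then for every $\beta\in\{1,2,w_1,w_2\}$ and every real $x\ge r(\sigma_\beta)$, $$I_\beta(x)=\sup_{\theta\ge 0}\{J_b(\sigma_\beta,\theta,x)-F(\theta,\beta)\},$$ where $b=\beta$ if $\beta\in\{1,2\}$ and $b=i$ if $\beta=w_i$. -/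

import Mathlib

open MeasureTheory Filter Topology Set

noncomputable section

namespace LargestEigenvalue

/-! ### Stieltjes transform, `R`-transform and the limit of spherical integrals -/

/-- The Stieltjes transform `G_μ(z) = ∫ (z - t)⁻¹ dμ(t)` at a real point `z`. -/
def stieltjes (μ : Measure ℝ) (z : ℝ) : ℝ := ∫ t, 1 / (z - t) ∂μ

/-- The left edge of the support of `μ`. -/
def leftEdge (μ : Measure ℝ) : ℝ := sInf μ.support

/-- The right edge `r(μ)` of the support of `μ`. -/
def rightEdge (μ : Measure ℝ) : ℝ := sSup μ.support

/-- `H_max(μ, l) = lim_{z ↓ l} ∫ (z - y)⁻¹ dμ(y)`, for `l ≥ r(μ)`. The limit is taken in the extended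
reals, where it always exists by monotonicity (it may be `+∞` at `l = r(μ)`). -/
def Hmax (μ : Measure ℝ) (l : ℝ) : EReal :=
  limUnder (𝓝[>] l) (fun z : ℝ => ((stieltjes μ z : ℝ) : EReal))

/-- The inverse `K_μ` of the bijection `G_μ` from `ℝ ∖ [a, b]` onto its image, with `a`, `b` the
edges of the support of `μ`. At the right end point `G_μ(b) = lim_{z ↓ b} G_μ(z)` (when finite) it
is extended by its limit, which is `b`. -/
def stieltjesInv (μ : Measure ℝ) (z : ℝ) : ℝ :=
  open Classical in
  if (z : EReal) = Hmax μ (rightEdge μ) then rightEdge μ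
  else Function.invFunOn (stieltjes μ) (Icc (leftEdge μ) (rightEdge μ))ᶜ z

/-- The `R`-transform `R_μ(z) = K_μ(z) - 1/z`, whose value at `z = 0` is the limit there, the mean
of `μ`. -/
def Rtransform (μ : Measure ℝ) (z : ℝ) : ℝ :=
  if z = 0 then ∫ t, t ∂μ else stieltjesInv μ z - 1 / z

/-- The function `v(θ, μ, l)` for the parameter `β`. -/
def vfun (β : ℝ) (μ : Measure ℝ) (θ l : ℝ) : ℝ :=
  open Classical in
  if ((2 / β * θ : ℝ) : EReal) ≤ Hmax μ l then Rtransform μ (2 / β * θ)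
  else l - β / (2 * θ)

/-- The limit `J(μ, θ, l)` of spherical integrals for the parameter `β`, for `θ ≥ 0`, `l ≥ r(μ)`. -/
def sphericalLimit (β : ℝ) (μ : Measure ℝ) (θ l : ℝ) : ℝ :=
  θ * vfun β μ θ l
    - β / 2 * ∫ y, Real.log (1 + 2 / β * θ * vfun β μ θ l - 2 / β * θ * y) ∂μ

/-! ### The four models -/

/-- The four models `1`, `2` (real and complex Wigner), `w₁`, `w₂` (real and complex Wishart). -/
inductive Model
  | wignerReal
  | wignerComplex
  | wishartReal
  | wishartComplex

/-- The parameter `1` for real entries, `2` for complex entries. -/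
def Model.beta : Model → ℝ
  | .wignerReal => 1
  | .wignerComplex => 2
  | .wishartReal => 1
  | .wishartComplex => 2

/-- The semicircle law, of density `(2π)⁻¹ √(4 - x²)` on `[-2, 2]`. -/
def semicircle : Measure ℝ :=
  (volume.restrict (Icc (-2) 2)).withDensity
    (fun x => ENNReal.ofReal (1 / (2 * Real.pi) * Real.sqrt (4 - x ^ 2)))

/-- The lower edge `(1 - √α)²`. -/
def mpLower (α : ℝ) : ℝ := (1 - Real.sqrt α) ^ 2

/-- The upper edge `(1 + √α)²`. -/
def mpUpper (α : ℝ) : ℝ := (1 + Real.sqrt α) ^ 2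

/-- The Pastur–Marchenko law `π_α`, for `α ≥ 1`. -/
def marchenkoPastur (α : ℝ) : Measure ℝ :=
  (volume.restrict (Icc (mpLower α) (mpUpper α))).withDensity
    (fun x => ENNReal.ofReal
      (Real.sqrt ((mpUpper α - x) * (x - mpLower α)) / (2 * Real.pi * x)))

/-- The law `σ_w`: `∫ f dσ_w` is
`(1+α)⁻¹ (∫ f(√(x/(1+α))) dπ_α + ∫ f(-√(x/(1+α))) dπ_α) + (α-1)/(α+1) f(0)`. -/
def wishartLaw (α : ℝ) : Measure ℝ :=
  ENNReal.ofReal (1 / (1 + α)) •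
      ((marchenkoPastur α).map (fun x => Real.sqrt (x / (1 + α)))
        + (marchenkoPastur α).map (fun x => -Real.sqrt (x / (1 + α))))
    + ENNReal.ofReal ((α - 1) / (α + 1)) • Measure.dirac 0

/-- The limiting spectral law `σ_β`; only the Wishart models depend on `α`. -/
def limitLaw (α : ℝ) : Model → Measure ℝ
  | .wignerReal => semicircle
  | .wignerComplex => semicircle
  | .wishartReal => wishartLaw α
  | .wishartComplex => wishartLaw α

/-- `θ² / b`, the function `F(θ, b)` for the Wigner models. -/
def wignerF (b θ : ℝ) : ℝ := θ ^ 2 / b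

/-- The constant `C_α`. -/
def wishartConst (α : ℝ) : ℝ :=
  1 / (2 * (1 + α)) * Real.log (1 / (1 + α)) + α / (2 * (1 + α)) * Real.log (α / (1 + α))

/-- The function `F(θ, w_b)` for the Wishart models. The supremum over `[0, 1]`, with the convention
`ln 0 = -∞`, is the supremum over the open interval `(0, 1)`. -/
def wishartF (α b θ : ℝ) : ℝ :=
  sSup ((fun x : ℝ => 2 * θ ^ 2 / b * (x * (1 - x)) + b / (2 * (1 + α)) * Real.log (1 - x)
      + b * α / (2 * (1 + α)) * Real.log x) '' Ioo 0 1)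
    - b * wishartConst α

/-- The function `F(θ, β)` for the four models. -/
def Ffun (α : ℝ) (θ : ℝ) : Model → ℝ
  | .wignerReal => wignerF 1 θ
  | .wignerComplex => wignerF 2 θ
  | .wishartReal => wishartF α 1 θ
  | .wishartComplex => wishartF α 2 θ

/-! ### The explicit rate functions -/

/-- The rate function of the Wigner models: `+∞` on `(-∞, 2)`, and `(b/2) ∫₂ˣ √(y² - 4) dy` on
`[2, ∞)`. -/
def wignerRate (b x : ℝ) : EReal :=
  if x < 2 then ⊤ else ((b / 2 * ∫ y in (2 : ℝ)..x, Real.sqrt (y ^ 2 - 4) : ℝ) : EReal)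

/-- The edge `√((1 + α)⁻¹ (1 + √α)²)` of the Wishart models. -/
def wishartEdge (α : ℝ) : ℝ := Real.sqrt ((1 + α)⁻¹ * mpUpper α)

/-- The rate function of the Wishart models: `+∞` below the edge, explicit from the edge on. -/
def wishartRate (α b x : ℝ) : EReal :=
  if x < wishartEdge α then ⊤
  else ((b / (1 + α) * ∫ y in (wishartEdge α)..x,
      1 / y * Real.sqrt ((1 + α) ^ 2 * (y ^ 2 - 1) ^ 2 - 4 * α) : ℝ) : EReal)

/-- The rate function `I_β` for the four models. -/
def rate (α : ℝ) (x : ℝ) : Model → EReal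
  | .wignerReal => wignerRate 1 x
  | .wignerComplex => wignerRate 2 x
  | .wishartReal => wishartRate α 1 x
  | .wishartComplex => wishartRate α 2 x

end LargestEigenvalue

end

open LargestEigenvalue

namespace LargestEigenvalue

/-! ### Stieltjes transform and logarithmic potential of a measure carried by `(-r, r)` -/

section Potential

variable {μ : Measure ℝ} [IsProbabilityMeasure μ] {r : ℝ}

/-! Put `u = 2θ/b` and `W(u) = (2/b) F(bu/2, β)`. Both families rest on a spectral curve with two
branches over `[r, ∞)`: the lower one `h` is the Stieltjes transform, and the upper one `q` meets it
at the edge `r`. On both branches `W'(u) = z - 1/u`. On `h` this says that `W` is a primitive of the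
`R`-transform; on `q` it continues that relation beyond the edge.

In both regimes of `v`, one has `J = (b/2)(uz - 1 - log u - ∫ log(z - t) dμ)`, with `z = K_μ(u)` or
`z = x`. If `u ≤ h(x)`, this equals `F`, so the difference is zero (`sphericalLimit_of_le`). If `u >
h(x)`, the difference is `b/2` times `profile μ W x u`, whose `u`-derivative is `x - z` at the curve
point `(z, u)`. It therefore increases up to `u = q(x)` and decreases afterwards (`profile_le`).
Along `(x, q(x))` only the `x`-derivative `q - h` survives, so the maximum is `∫_r^x (q - h)`
(`profile_upper_eq_integral`), which is the explicit rate.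

What remains is to exhibit the curves. For the semicircle it is `u + 1/u = z` with `W = u²/2`. For
`σ_w`, `W` is itself a supremum; its maximiser is rational on the curve, and the envelope theorem
gives `W'` (`hasDerivAt_wishartW_branch`). -/

/-- The logarithmic potential `∫ log (z - t) dμ(t)`. -/
noncomputable def logPotential (μ : Measure ℝ) (z : ℝ) : ℝ := ∫ t, Real.log (z - t) ∂μ

lemma measurable_one_div_sub (z : ℝ) : Measurable fun t : ℝ => 1 / (z - t) :=
  measurable_const.div (measurable_const.sub measurable_id)

lemma integrable_one_div_sub (hμ : ∀ᵐ t ∂μ, t ∈ Ioo (-r) r) {z : ℝ} (hz : r < z) :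
    Integrable (fun t => 1 / (z - t)) μ := by
  refine Integrable.of_bound (C := 1 / (z - r))
    (measurable_one_div_sub z).aestronglyMeasurable ?_
  filter_upwards [hμ] with t ht
  rw [Real.norm_of_nonneg (one_div_nonneg.2 (by linarith [ht.2]))]
  exact one_div_le_one_div_of_le (by linarith) (by linarith [ht.2])

lemma integrable_log_sub (hμ : ∀ᵐ t ∂μ, t ∈ Ioo (-r) r) {z : ℝ} (hz : r < z) :
    Integrable (fun t => Real.log (z - t)) μ := by
  refine Integrable.of_bound (C := |Real.log (z - r)| + |Real.log (z + r)|)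
    (Measurable.aestronglyMeasurable (by fun_prop)) ?_
  filter_upwards [hμ] with t ht
  have h1 := Real.log_le_log (by linarith) (by linarith [ht.2] : z - r ≤ z - t)
  have h2 := Real.log_le_log (by linarith [ht.2]) (by linarith [ht.1] : z - t ≤ z + r)
  rw [Real.norm_eq_abs, abs_le]
  constructor
  · linarith [neg_abs_le (Real.log (z - r)), abs_nonneg (Real.log (z + r))]
  · linarith [le_abs_self (Real.log (z + r)), abs_nonneg (Real.log (z - r))]

/-- Since `|t| < r`, the difference of the integrands is at least a positive constant, so strictness
survives integration. -/
lemma stieltjes_lt_stieltjes (hμ : ∀ᵐ t ∂μ, t ∈ Ioo (-r) r) {z w : ℝ} (hr : 0 < r) (hz : r < z)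
    (hzw : z < w) : stieltjes μ w < stieltjes μ z := by
  have hc : 0 < (w - z) / ((w + r) * (z + r)) :=
    div_pos (by linarith) (mul_pos (by linarith) (by linarith))
  have key : ∫ _, (w - z) / ((w + r) * (z + r)) ∂μ
      ≤ ∫ t, (1 / (z - t) - 1 / (w - t)) ∂μ := by
    refine integral_mono_ae (integrable_const _)
      ((integrable_one_div_sub hμ hz).sub (integrable_one_div_sub hμ (hz.trans hzw))) ?_
    filter_upwards [hμ] with t ht
    have h1 : 0 < z - t := by linarith [ht.2]
    have h2 : 0 < w - t := by linarith [ht.2]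
    rw [div_sub_div _ _ h1.ne' h2.ne', div_le_div_iff₀ (mul_pos (by linarith) (by linarith))
      (mul_pos h1 h2)]
    have h3 : (z - t) * (w - t) ≤ (w + r) * (z + r) := by
      rw [mul_comm (w + r)]
      exact mul_le_mul (by linarith [ht.1]) (by linarith [ht.1]) h2.le (by linarith)
    nlinarith
  rw [integral_sub (integrable_one_div_sub hμ hz) (integrable_one_div_sub hμ (hz.trans hzw))] at key
  simp only [integral_const, probReal_univ, one_smul] at key
  unfold stieltjes
  linarith

lemma stieltjes_pos (hμ : ∀ᵐ t ∂μ, t ∈ Ioo (-r) r) {z : ℝ} (hr : 0 < r) (hz : r < z) :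
    0 < stieltjes μ z := by
  have key : ∫ _, 1 / (z + r) ∂μ ≤ ∫ t, 1 / (z - t) ∂μ := by
    refine integral_mono_ae (integrable_const _) (integrable_one_div_sub hμ hz) ?_
    filter_upwards [hμ] with t ht
    exact one_div_le_one_div_of_le (by linarith [ht.2]) (by linarith [ht.1])
  simp only [integral_const, probReal_univ, one_smul] at key
  exact (one_div_pos.2 (by linarith)).trans_le key

lemma abs_mul_stieltjes_sub_one_le (hμ : ∀ᵐ t ∂μ, t ∈ Ioo (-r) r) {z : ℝ} (hz : r < z) :
    |z * stieltjes μ z - 1| ≤ r / (z - r) := by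
  have h1 : z * stieltjes μ z - 1 = ∫ t, (z * (1 / (z - t)) - 1) ∂μ := by
    rw [integral_sub ((integrable_one_div_sub hμ hz).const_mul z) (integrable_const _),
      integral_const_mul]
    simp [stieltjes]
  rw [h1, ← Real.norm_eq_abs]
  refine (norm_integral_le_of_norm_le_const (C := r / (z - r)) ?_).trans (by simp)
  filter_upwards [hμ] with t ht
  have h2 : 0 < z - t := by linarith [ht.2]
  have h3 : z * (1 / (z - t)) - 1 = t / (z - t) := by field_simp; ring
  rw [h3, Real.norm_eq_abs, abs_div, abs_of_pos h2]
  have h4 : |t| ≤ r := abs_le.2 ⟨ht.1.le, ht.2.le⟩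
  exact div_le_div₀ ((abs_nonneg t).trans h4) h4 (by linarith) (by linarith [ht.2])

lemma tendsto_div_sub_atTop (c r : ℝ) : Tendsto (fun z : ℝ => c / (z - r)) atTop (𝓝 0) :=
  (tendsto_atTop_add_const_right _ (-r) tendsto_id).const_div_atTop c

lemma tendsto_mul_stieltjes (hμ : ∀ᵐ t ∂μ, t ∈ Ioo (-r) r) :
    Tendsto (fun z => z * stieltjes μ z) atTop (𝓝 1) := by
  rw [tendsto_iff_norm_sub_tendsto_zero]
  refine squeeze_zero' (Eventually.of_forall fun _ => norm_nonneg _) ?_ (tendsto_div_sub_atTop r r)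
  filter_upwards [eventually_gt_atTop r] with z hz
  exact abs_mul_stieltjes_sub_one_le hμ hz

lemma hasDerivAt_logPotential (hμ : ∀ᵐ t ∂μ, t ∈ Ioo (-r) r) {z : ℝ} (hz : r < z) :
    HasDerivAt (logPotential μ) (stieltjes μ z) z := by
  -- Beyond this midpoint the differentiated integrand has a constant bound.
  have hmid : (r + z) / 2 < z := by linarith
  refine (hasDerivAt_integral_of_dominated_loc_of_deriv_le (μ := μ)
    (F := fun z t => Real.log (z - t)) (F' := fun z t => 1 / (z - t))
    (bound := fun _ => 1 / ((r + z) / 2 - r)) (Ioi_mem_nhds hmid) ?_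
    (integrable_log_sub hμ hz) (measurable_one_div_sub z).aestronglyMeasurable ?_ (integrable_const _) ?_).2
  · exact Eventually.of_forall fun w => Measurable.aestronglyMeasurable (by fun_prop)
  · filter_upwards [hμ] with t ht w hw
    have hw' : (r + z) / 2 < w := hw
    rw [Real.norm_of_nonneg (one_div_nonneg.2 (by linarith [ht.2]))]
    exact one_div_le_one_div_of_le (by linarith) (by linarith [ht.2])
  · filter_upwards [hμ] with t ht w hw
    have hw' : (r + z) / 2 < w := hw
    exact ((hasDerivAt_id w).sub_const t).log (by simp only [id]; linarith [ht.2])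

/-- The bound `log y ≤ y - 1`, applied to `(z - t)/z` and to its inverse, controls both sides
uniformly in `t`. -/
lemma tendsto_logPotential_sub_log (hμ : ∀ᵐ t ∂μ, t ∈ Ioo (-r) r) (hr : 0 < r) :
    Tendsto (fun z => logPotential μ z - Real.log z) atTop (𝓝 0) := by
  rw [tendsto_zero_iff_norm_tendsto_zero]
  refine squeeze_zero' (Eventually.of_forall fun _ => norm_nonneg _) ?_ (tendsto_div_sub_atTop r r)
  filter_upwards [eventually_gt_atTop r] with z hz
  have h1 : logPotential μ z - Real.log z = ∫ t, (Real.log (z - t) - Real.log z) ∂μ := by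
    rw [integral_sub (integrable_log_sub hμ hz) (integrable_const _)]
    simp [logPotential]
  rw [h1]
  refine (norm_integral_le_of_norm_le_const (C := r / (z - r)) ?_).trans (by simp)
  filter_upwards [hμ] with t ht
  have hz0 : 0 < z := hr.trans hz
  have h2 : 0 < z - t := by linarith [ht.2]
  have hzr : 0 < z - r := by linarith
  rw [← Real.log_div h2.ne' hz0.ne', Real.norm_eq_abs, abs_le]
  constructor
  · have h3 := Real.log_le_sub_one_of_pos (div_pos hz0 h2)
    rw [← inv_div z (z - t), Real.log_inv]
    have h4 : z / (z - t) - 1 ≤ r / (z - r) := by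
      rw [div_sub_one h2.ne', sub_sub_cancel]
      exact (div_le_div_of_nonneg_right ht.2.le h2.le).trans
        (div_le_div_of_nonneg_left hr.le hzr (by linarith [ht.2]))
    linarith
  · refine (Real.log_le_sub_one_of_pos (div_pos h2 hz0)).trans ?_
    rw [div_sub_one hz0.ne', div_le_div_iff₀ hz0 hzr]
    nlinarith [ht.1, ht.2]

/-- Fatou along `r + 1/(n+1) ↓ r`. This yields the dominating function that carries the logarithmic
potential to the edge. -/
lemma integrable_one_div_edge_sub (hμ : ∀ᵐ t ∂μ, t ∈ Ioo (-r) r) {C : ℝ}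
    (hC : ∀ z, r < z → stieltjes μ z ≤ C) : Integrable (fun t => 1 / (r - t)) μ := by
  let z : ℕ → ℝ := fun n => r + 1 / ((n : ℝ) + 1)
  have hz : ∀ n, r < z n := fun n => by
    have : (0 : ℝ) < 1 / ((n : ℝ) + 1) := by positivity
    simp only [z]; linarith
  have hzlim : Tendsto z atTop (𝓝 r) := by
    simpa [z] using (tendsto_const_nhds (x := r)).add tendsto_one_div_add_atTop_nhds_zero_nat
  refine integrable_of_tendsto (G := fun n t => 1 / (z n - t)) ?_
    (fun n => (measurable_one_div_sub (z n)).aestronglyMeasurable) ?_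
  · filter_upwards [hμ] with t ht
    exact (tendsto_const_nhds).div (hzlim.sub_const t) (by linarith [ht.2])
  · refine ne_top_of_le_ne_top (ENNReal.ofReal_ne_top (r := C)) ?_
    refine liminf_le_of_le (by isBoundedDefault) fun b hb => ?_
    obtain ⟨n, hn⟩ := hb.exists
    refine hn.trans ?_
    rw [← ofReal_integral_norm_eq_lintegral_enorm (integrable_one_div_sub hμ (hz n))]
    refine ENNReal.ofReal_le_ofReal ?_
    refine le_trans (le_of_eq ?_) (hC _ (hz n))
    refine integral_congr_ae ?_
    filter_upwards [hμ] with t ht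
    exact Real.norm_of_nonneg (one_div_nonneg.2 (by linarith [ht.2, hz n]))

lemma abs_log_sub_le {t z : ℝ} (hr : 0 < r) (ht : t ∈ Ioo (-r) r) (hz : r ≤ z) (hz' : z ≤ r + 1) :
    |Real.log (z - t)| ≤ (2 * r + 1) + 1 / (r - t) := by
  have h1 : 0 < z - t := by linarith [ht.2]
  have h2 : 0 < r - t := by linarith [ht.2]
  have h3 : 0 < 1 / (r - t) := one_div_pos.2 h2
  rw [abs_le]
  constructor
  · have h4 := Real.log_le_sub_one_of_pos h3
    rw [one_div, Real.log_inv, ← one_div] at h4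
    linarith [Real.log_le_log h2 (by linarith : r - t ≤ z - t)]
  · linarith [Real.log_le_sub_one_of_pos h1, ht.1]

lemma integrable_log_sub_of_le (hμ : ∀ᵐ t ∂μ, t ∈ Ioo (-r) r) {C : ℝ} (hr : 0 < r)
    (hC : ∀ z, r < z → stieltjes μ z ≤ C) {z : ℝ} (hz : r ≤ z) :
    Integrable (fun t => Real.log (z - t)) μ := by
  rcases hz.eq_or_lt with rfl | hz
  · refine Integrable.mono' ((integrable_const (2 * r + 1)).add (integrable_one_div_edge_sub hμ hC))
      (Measurable.aestronglyMeasurable (by fun_prop)) ?_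
    filter_upwards [hμ] with t ht
    exact abs_log_sub_le hr ht le_rfl (by linarith)
  · exact integrable_log_sub hμ hz

lemma continuousOn_logPotential (hμ : ∀ᵐ t ∂μ, t ∈ Ioo (-r) r) {C : ℝ} (hr : 0 < r)
    (hC : ∀ z, r < z → stieltjes μ z ≤ C) : ContinuousOn (logPotential μ) (Ici r) := by
  intro z hz
  rcases (mem_Ici.1 hz).eq_or_lt with rfl | hz
  · refine continuousWithinAt_of_dominated (bound := fun t => (2 * r + 1) + 1 / (r - t)) ?_ ?_
      ((integrable_const _).add (integrable_one_div_edge_sub hμ hC)) ?_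
    · exact Eventually.of_forall fun w => Measurable.aestronglyMeasurable (by fun_prop)
    · filter_upwards [self_mem_nhdsWithin,
        mem_nhdsWithin_of_mem_nhds (Iio_mem_nhds (by linarith : r < r + 1))] with w hw hw'
      filter_upwards [hμ] with t ht
      exact abs_log_sub_le hr ht hw (le_of_lt hw')
    · filter_upwards [hμ] with t ht
      exact (ContinuousAt.log (by fun_prop) (by linarith [ht.2])).continuousWithinAt
  · exact (hasDerivAt_logPotential hμ hz).continuousAt.continuousWithinAt

end Potential

/-- Used to show that the inverse of `G_μ` at a positive value never lands to the left of the
support. -/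
lemma stieltjes_nonpos_of_lt_leftEdge {μ : Measure ℝ} {r : ℝ}
    (hμ : ∀ᵐ t ∂μ, t ∈ Ioo (-r) r) {z : ℝ}
    (hz : z < leftEdge μ) : stieltjes μ z ≤ 0 := by
  have hsub : μ.support ⊆ Icc (-r) r := by
    refine Measure.support_subset_of_isClosed isClosed_Icc ?_
    filter_upwards [hμ] with t ht using Ioo_subset_Icc_self ht
  refine integral_nonpos_of_ae ?_
  filter_upwards [Measure.support_mem_ae (μ := μ)] with t ht
  have h1 : leftEdge μ ≤ t := csInf_le ⟨-r, fun s hs => (hsub hs).1⟩ ht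
  exact one_div_nonpos.2 (by linarith)

lemma rightEdge_eq {μ : Measure ℝ} {r : ℝ} (hμ : ∀ᵐ t ∂μ, t ∈ Ioo (-r) r)
    (hr : r ∈ μ.support) : rightEdge μ = r := by
  have hsub : μ.support ⊆ Icc (-r) r := by
    refine Measure.support_subset_of_isClosed isClosed_Icc ?_
    filter_upwards [hμ] with t ht using Ioo_subset_Icc_self ht
  exact IsGreatest.csSup_eq ⟨hr, fun s hs => (hsub hs).2⟩

set_option linter.unusedSectionVars false

/-! ### The variational formula on a spectral curve -/

/-- `h` is the Stieltjes transform of `μ` on `(r, ∞)`, with `r` the right edge of `μ`, `q` is a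
second branch meeting `h` at `r`, and on both branches `W'(u) = z - 1/u`. -/
structure IsSpectralCurve (μ : Measure ℝ) (r : ℝ) (h q W : ℝ → ℝ) : Prop where
  pos : 0 < r
  ae_mem : ∀ᵐ t ∂μ, t ∈ Ioo (-r) r
  mem_support : r ∈ μ.support
  stieltjes_eq : ∀ z, r < z → stieltjes μ z = h z
  continuousOn_lower : ContinuousOn h (Ici r)
  continuousOn_upper : ContinuousOn q (Ici r)
  edge_eq : q r = h r
  tendsto_upper : Tendsto q atTop atTop
  W_zero : W 0 = 0
  continuousAt_W : ContinuousAt W 0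
  continuousOn_W_lower : ContinuousOn (fun z => W (h z)) (Ici r)
  continuousOn_W_upper : ContinuousOn (fun z => W (q z)) (Ici r)
  lower_deriv : ∀ z, r < z → ∃ h', HasDerivAt h h' z ∧
    HasDerivAt (fun z => W (h z)) (h' * (z - 1 / h z)) z
  upper_deriv : ∀ z, r < z → ∃ q', 0 ≤ q' ∧ HasDerivAt q q' z ∧
    HasDerivAt (fun z => W (q z)) (q' * (z - 1 / q z)) z

/-- The function `u x - 1 - log u - ∫ log (x - t) dμ(t) - W u`. -/
noncomputable def profile (μ : Measure ℝ) (W : ℝ → ℝ) (x u : ℝ) : ℝ :=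
  u * x - 1 - Real.log u - logPotential μ x - W u

namespace IsSpectralCurve

variable {μ : Measure ℝ} [IsProbabilityMeasure μ] {r : ℝ} {h q W : ℝ → ℝ}

/-! ### Monotonicity and sign of the two branches. -/

lemma lower_strictAntiOn (H : IsSpectralCurve μ r h q W) : StrictAntiOn h (Ici r) := by
  have key : ∀ z w, r < z → z < w → h w < h z := fun z w hz hzw => by
    rw [← H.stieltjes_eq z hz, ← H.stieltjes_eq w (hz.trans hzw)]
    exact stieltjes_lt_stieltjes H.ae_mem H.pos hz hzw
  intro z hz w _ hzw
  rcases (mem_Ici.1 hz).eq_or_lt with rfl | hz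
  -- The midpoint leaves room for the inequality to stay strict in the limit at `r`.
  · have hm : r < (r + w) / 2 := by linarith
    refine (key _ _ hm (by linarith)).trans_le ?_
    have hlim : Tendsto h (𝓝[>] r) (𝓝 (h r)) :=
      (H.continuousOn_lower r self_mem_Ici).mono Ioi_subset_Ici_self
    refine ge_of_tendsto hlim ?_
    filter_upwards [Ioo_mem_nhdsGT hm] with y hy
    exact (key _ _ hy.1 hy.2).le
  · exact key _ _ hz hzw

lemma lower_pos (H : IsSpectralCurve μ r h q W) {z : ℝ} (hz : r ≤ z) : 0 < h z := by
  have h1 : h (z + 1) < h z := H.lower_strictAntiOn hz (by simp; linarith) (by linarith)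
  have h2 : 0 < h (z + 1) := by
    rw [← H.stieltjes_eq _ (by linarith)]
    exact stieltjes_pos H.ae_mem H.pos (by linarith)
  exact h2.trans h1

lemma lower_deriv_nonpos (H : IsSpectralCurve μ r h q W) {z h' : ℝ} (hz : r < z)
    (hd : HasDerivAt h h' z) : h' ≤ 0 := by
  have h1 := (H.lower_strictAntiOn.antitoneOn).derivWithin_nonpos (x := z)
  rwa [derivWithin_of_mem_nhds (Ici_mem_nhds hz), hd.deriv] at h1

lemma stieltjes_le (H : IsSpectralCurve μ r h q W) (z : ℝ) (hz : r < z) :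
    stieltjes μ z ≤ h r := by
  rw [H.stieltjes_eq z hz]
  exact (H.lower_strictAntiOn self_mem_Ici hz.le hz).le

lemma tendsto_mul_lower (H : IsSpectralCurve μ r h q W) :
    Tendsto (fun z => z * h z) atTop (𝓝 1) := by
  refine (tendsto_mul_stieltjes H.ae_mem).congr' ?_
  filter_upwards [eventually_gt_atTop r] with z hz
  rw [H.stieltjes_eq z hz]

lemma tendsto_lower (H : IsSpectralCurve μ r h q W) : Tendsto h atTop (𝓝 0) := by
  have h1 := H.tendsto_mul_lower.mul tendsto_inv_atTop_zero
  rw [mul_zero] at h1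
  refine h1.congr' ?_
  filter_upwards [eventually_gt_atTop 0] with z hz
  field_simp

lemma upper_monotoneOn (H : IsSpectralCurve μ r h q W) : MonotoneOn q (Ici r) := by
  choose! q' hq' hd _ using H.upper_deriv
  refine monotoneOn_of_hasDerivWithinAt_nonneg (f' := q') (convex_Ici r) H.continuousOn_upper ?_ ?_
  · intro z hz
    rw [interior_Ici] at hz
    exact (hd z hz).hasDerivWithinAt
  · intro z hz
    rw [interior_Ici] at hz
    exact hq' z hz

lemma upper_pos (H : IsSpectralCurve μ r h q W) {z : ℝ} (hz : r ≤ z) : 0 < q z := by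
  have h1 : q r ≤ q z := H.upper_monotoneOn self_mem_Ici hz hz
  rw [H.edge_eq] at h1
  exact (H.lower_pos le_rfl).trans_le h1

/-! ### The profile along the two branches. -/

lemma continuousOn_potential (H : IsSpectralCurve μ r h q W) :
    ContinuousOn (logPotential μ) (Ici r) :=
  continuousOn_logPotential H.ae_mem H.pos H.stieltjes_le

lemma hasDerivAt_potential (H : IsSpectralCurve μ r h q W) {z : ℝ} (hz : r < z) :
    HasDerivAt (logPotential μ) (h z) z := by
  rw [← H.stieltjes_eq z hz]
  exact hasDerivAt_logPotential H.ae_mem hz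

/-- Along the lower branch both partial derivatives vanish: `z - 1/u - W'(u)` by the curve, and `u -
G_μ(z)` because `u = h(z)`. The constant value is read off at infinity. -/
lemma profile_lower_eq_zero (H : IsSpectralCurve μ r h q W) {z : ℝ} (hz : r ≤ z) :
    profile μ W z (h z) = 0 := by
  have hcont : ContinuousOn (fun z => profile μ W z (h z)) (Ici r) := by
    unfold profile
    exact ((((H.continuousOn_lower.mul continuousOn_id).sub continuousOn_const).sub
      (H.continuousOn_lower.log fun z hz => (H.lower_pos hz).ne')).sub
      H.continuousOn_potential).sub H.continuousOn_W_lower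
  have hderiv : ∀ z ∈ interior (Ici r),
      HasDerivWithinAt (fun z => profile μ W z (h z)) ((fun _ => (0 : ℝ)) z) (interior (Ici r)) z := by
    intro z hz
    rw [interior_Ici] at hz
    obtain ⟨h', hd, hW⟩ := H.lower_deriv z hz
    have h0 := (H.lower_pos (le_of_lt hz)).ne'
    have := ((((hd.mul (hasDerivAt_id z)).sub_const 1).sub (hd.log h0)).sub
      (H.hasDerivAt_potential hz)).sub hW
    refine (this.congr_deriv ?_).hasDerivWithinAt
    simp only [id]
    field_simp
    ring
  have hmono := monotoneOn_of_hasDerivWithinAt_nonneg (convex_Ici r) hcont hderiv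
    fun _ _ => le_rfl
  have hanti := antitoneOn_of_hasDerivWithinAt_nonpos (convex_Ici r) hcont hderiv
    fun _ _ => le_rfl
  have hlim : Tendsto (fun z => profile μ W z (h z)) atTop (𝓝 0) := by
    have h1 := H.tendsto_mul_lower
    have h2 : Tendsto (fun z => Real.log (z * h z)) atTop (𝓝 0) := by
      simpa using h1.log one_ne_zero
    have h3 := tendsto_logPotential_sub_log H.ae_mem H.pos
    have h4 : Tendsto (fun z => W (h z)) atTop (𝓝 0) := by
      have := H.continuousAt_W.tendsto.comp H.tendsto_lower
      rwa [H.W_zero] at this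
    -- Regrouping as `(zh - 1) - log(zh) - (∫ log(z - t) dμ - log z) - W(h)` makes each term tend to
    -- zero.
    have h5 := (((h1.sub_const 1).sub h2).sub h3).sub h4
    simp only [sub_self] at h5
    refine h5.congr' ?_
    filter_upwards [eventually_gt_atTop r] with z hz
    rw [Real.log_mul (H.pos.trans hz).ne' (H.lower_pos hz.le).ne', profile]
    ring
  refine (tendsto_nhds_unique (hlim.congr' ?_) tendsto_const_nhds).symm
  filter_upwards [eventually_ge_atTop z] with w hw
  exact le_antisymm (hanti hz (hz.trans hw) hw) (hmono hz (hz.trans hw) hw)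

/-- Along the upper branch the `u`-derivative still vanishes, but the `z`-derivative is `q - h`. The
initial value is zero because the branches meet at `r`. -/
lemma profile_upper_eq_integral (H : IsSpectralCurve μ r h q W) {x : ℝ} (hx : r ≤ x) :
    profile μ W x (q x) = ∫ y in r..x, (q y - h y) := by
  have hcont : ContinuousOn (fun z => profile μ W z (q z)) (Ici r) := by
    unfold profile
    exact ((((H.continuousOn_upper.mul continuousOn_id).sub continuousOn_const).sub
      (H.continuousOn_upper.log fun z hz => (H.upper_pos hz).ne')).sub
      H.continuousOn_potential).sub H.continuousOn_W_upper
  have hderiv : ∀ z ∈ Ioo r x, HasDerivAt (fun z => profile μ W z (q z)) (q z - h z) z := by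
    intro z hz
    obtain ⟨q', -, hd, hW⟩ := H.upper_deriv z hz.1
    have h0 := (H.upper_pos hz.1.le).ne'
    have := ((((hd.mul (hasDerivAt_id z)).sub_const 1).sub (hd.log h0)).sub
      (H.hasDerivAt_potential hz.1)).sub hW
    refine this.congr_deriv ?_
    simp only [id]
    field_simp
    ring
  have hint : IntervalIntegrable (fun y => q y - h y) volume r x := by
    refine ContinuousOn.intervalIntegrable ?_
    rw [uIcc_of_le hx]
    exact (H.continuousOn_upper.sub H.continuousOn_lower).mono Icc_subset_Ici_self
  rw [intervalIntegral.integral_eq_sub_of_hasDerivAt_of_le hx (hcont.mono Icc_subset_Ici_self)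
    hderiv hint]
  have h0 : profile μ W r (q r) = 0 := by
    rw [H.edge_eq]; exact H.profile_lower_eq_zero le_rfl
  rw [h0, sub_zero]

lemma profile_lower_antitoneOn (H : IsSpectralCurve μ r h q W) (x : ℝ) :
    AntitoneOn (fun z => profile μ W x (h z)) (Icc r x) := by
  choose! h' hd hW using H.lower_deriv
  refine antitoneOn_of_hasDerivWithinAt_nonpos (f' := fun z => h' z * (x - z)) (convex_Icc r x)
    ?_ ?_ ?_
  · refine ContinuousOn.mono ?_ (Icc_subset_Ici_self : Icc r x ⊆ Ici r)
    unfold profile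
    exact ((((H.continuousOn_lower.mul continuousOn_const).sub continuousOn_const).sub
      (H.continuousOn_lower.log fun z hz => (H.lower_pos hz).ne')).sub
      continuousOn_const).sub H.continuousOn_W_lower
  · intro z hz
    rw [interior_Icc] at hz
    have h0 := (H.lower_pos hz.1.le).ne'
    have := (((((hd z hz.1).mul_const x).sub_const 1).sub ((hd z hz.1).log h0)).sub_const
      (logPotential μ x)).sub (hW z hz.1)
    refine (this.congr_deriv ?_).hasDerivWithinAt
    field_simp
    ring
  · intro z hz
    rw [interior_Icc] at hz
    exact mul_nonpos_of_nonpos_of_nonneg (H.lower_deriv_nonpos hz.1 (hd z hz.1))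
      (by linarith [hz.2])

lemma hasDerivAt_profile_upper (H : IsSpectralCurve μ r h q W) (x : ℝ) {z : ℝ} (hz : r < z) :
    ∃ q', 0 ≤ q' ∧ HasDerivAt (fun z => profile μ W x (q z)) (q' * (x - z)) z := by
  obtain ⟨q', hq', hd, hW⟩ := H.upper_deriv z hz
  have h0 := (H.upper_pos hz.le).ne'
  have := ((((hd.mul_const x).sub_const 1).sub (hd.log h0)).sub_const (logPotential μ x)).sub hW
  refine ⟨q', hq', this.congr_deriv ?_⟩
  field_simp
  ring

/-- The derivative in `z` is `q'(z)(x - z)` with `q' ≥ 0`, so its sign can change only at `z = x`,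
from plus to minus. -/
lemma profile_upper_le (H : IsSpectralCurve μ r h q W) {x z : ℝ} (hx : r ≤ x) (hz : r ≤ z) :
    profile μ W x (q z) ≤ profile μ W x (q x) := by
  have hcont : ContinuousOn (fun z => profile μ W x (q z)) (Ici r) := by
    unfold profile
    exact ((((H.continuousOn_upper.mul continuousOn_const).sub continuousOn_const).sub
      (H.continuousOn_upper.log fun z hz => (H.upper_pos hz).ne')).sub
      continuousOn_const).sub H.continuousOn_W_upper
  choose! q' hq' hd using fun z (hz : r < z) => H.hasDerivAt_profile_upper x hz
  rcases le_total z x with hzx | hxz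
  · have hmono : MonotoneOn (fun z => profile μ W x (q z)) (Icc r x) := by
      refine monotoneOn_of_hasDerivWithinAt_nonneg (f' := fun z => q' z * (x - z)) (convex_Icc r x)
        (hcont.mono Icc_subset_Ici_self) ?_ ?_
      · intro z hz
        rw [interior_Icc] at hz
        exact (hd z hz.1).hasDerivWithinAt
      · intro z hz
        rw [interior_Icc] at hz
        exact mul_nonneg (hq' z hz.1) (by linarith [hz.2])
    exact hmono ⟨hz, hzx⟩ ⟨hx, le_rfl⟩ hzx
  · have hanti : AntitoneOn (fun z => profile μ W x (q z)) (Ici x) := by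
      refine antitoneOn_of_hasDerivWithinAt_nonpos (f' := fun z => q' z * (x - z)) (convex_Ici x)
        (hcont.mono (Ici_subset_Ici.2 hx)) ?_ ?_
      · intro z hz
        rw [interior_Ici] at hz
        exact (hd z (hx.trans_lt hz)).hasDerivWithinAt
      · intro z hz
        rw [interior_Ici] at hz
        exact mul_nonpos_of_nonneg_of_nonpos (hq' z (hx.trans_lt hz)) (by linarith [mem_Ioi.1 hz])
    exact hanti self_mem_Ici hxz hxz

/-! ### Parametrising `u` by the branches, and the maximum of the profile. -/

lemma exists_lower_eq (H : IsSpectralCurve μ r h q W) {x u : ℝ} (hx : r ≤ x) (hu : 0 < u)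
    (hux : u ≤ h x) : ∃ z, x ≤ z ∧ h z = u := by
  obtain ⟨w, hw, hxw⟩ := ((H.tendsto_lower.eventually (gt_mem_nhds hu)).and
    (eventually_ge_atTop x)).exists
  obtain ⟨z, hz, hzu⟩ := intermediate_value_Icc' hxw
    (H.continuousOn_lower.mono (Icc_subset_Ici_self.trans (Ici_subset_Ici.2 hx))) ⟨hw.le, hux⟩
  exact ⟨z, hz.1, hzu⟩

lemma exists_upper_eq (H : IsSpectralCurve μ r h q W) {u : ℝ} (hu : h r ≤ u) :
    ∃ z, r ≤ z ∧ q z = u := by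
  obtain ⟨w, hw, hrw⟩ := ((H.tendsto_upper.eventually (eventually_ge_atTop u)).and
    (eventually_ge_atTop r)).exists
  obtain ⟨z, hz, hzu⟩ := intermediate_value_Icc hrw
    (H.continuousOn_upper.mono Icc_subset_Ici_self) ⟨H.edge_eq.trans_le hu, hw⟩
  exact ⟨z, hz.1, hzu⟩

/-- If `u` is on the lower branch, moving `z` from its position in `[r, x]` back to `r` does not
decrease the profile. At `r` one passes to the upper branch. -/
lemma profile_le (H : IsSpectralCurve μ r h q W) {x u : ℝ} (hx : r ≤ x) (hu : h x < u) :
    profile μ W x u ≤ profile μ W x (q x) := by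
  rcases le_total u (h r) with hur | hur
  · obtain ⟨z, hz, rfl⟩ := H.exists_lower_eq le_rfl ((H.lower_pos hx).trans hu) hur
    have hzx : z ≤ x := by
      by_contra hcon
      exact absurd (H.lower_strictAntiOn hx hz (not_le.1 hcon)) (not_lt.2 hu.le)
    refine (H.profile_lower_antitoneOn x ⟨le_rfl, hx⟩ ⟨hz, hzx⟩ hz).trans ?_
    simp only
    rw [← H.edge_eq]
    exact H.profile_upper_le hx le_rfl
  · obtain ⟨z, hz, rfl⟩ := H.exists_upper_eq hur
    exact H.profile_upper_le hx hz

/-! ### Identification of `H_max`, `K_μ` and `J` on the curve. -/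

lemma Hmax_eq (H : IsSpectralCurve μ r h q W) {x : ℝ} (hx : r ≤ x) :
    Hmax μ x = ((h x : ℝ) : EReal) := by
  refine Tendsto.limUnder_eq ?_
  have h1 : Tendsto h (𝓝[>] x) (𝓝 (h x)) :=
    (H.continuousOn_lower x hx).mono (Ioi_subset_Ici_self.trans (Ici_subset_Ici.2 hx))
  have h2 : Tendsto (fun z => stieltjes μ z) (𝓝[>] x) (𝓝 (h x)) := by
    refine h1.congr' ?_
    filter_upwards [self_mem_nhdsWithin] with z hz
    exact (H.stieltjes_eq z (hx.trans_lt hz)).symm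
  exact (continuous_coe_real_ereal.tendsto _).comp h2

lemma rightEdge_eq (H : IsSpectralCurve μ r h q W) : rightEdge μ = r :=
  LargestEigenvalue.rightEdge_eq H.ae_mem H.mem_support

lemma stieltjesInv_lower (H : IsSpectralCurve μ r h q W) {z : ℝ} (hz : r ≤ z) :
    stieltjesInv μ (h z) = z := by
  rw [stieltjesInv, H.rightEdge_eq, H.Hmax_eq le_rfl]
  rcases hz.eq_or_lt with rfl | hz'
  · rw [if_pos rfl]
  · have hne : ((h z : ℝ) : EReal) ≠ (h r : ℝ) := by
      rw [Ne, EReal.coe_eq_coe_iff]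
      exact (H.lower_strictAntiOn self_mem_Ici hz hz').ne
    rw [if_neg hne]
    have hex : ∃ a ∈ (Icc (leftEdge μ) r)ᶜ, stieltjes μ a = h z :=
      ⟨z, fun hmem => absurd hmem.2 (not_le.2 hz'), H.stieltjes_eq z hz'⟩
    have hmem := Function.invFunOn_mem hex
    have heq := Function.invFunOn_eq hex
    set w := Function.invFunOn (stieltjes μ) (Icc (leftEdge μ) r)ᶜ (h z)
    -- The chosen preimage could a priori lie left of the support, but `G_μ ≤ 0` there while `h z >
    -- 0`.
    have hrw : r < w := by
      by_contra hcon
      have hlt : w < leftEdge μ := by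
        by_contra hl
        exact hmem ⟨not_lt.1 hl, not_lt.1 hcon⟩
      have := stieltjes_nonpos_of_lt_leftEdge H.ae_mem hlt
      rw [heq] at this
      exact absurd (H.lower_pos hz) (not_lt.2 this)
    rw [H.stieltjes_eq w hrw] at heq
    exact H.lower_strictAntiOn.injOn hrw.le hz heq

lemma integral_log_mul_sub (H : IsSpectralCurve μ r h q W) {z u : ℝ} (hz : r ≤ z) (hu : 0 < u) :
    ∫ y, Real.log (u * (z - y)) ∂μ = Real.log u + logPotential μ z := by
  have h1 : ∫ y, Real.log (u * (z - y)) ∂μ = ∫ y, (Real.log u + Real.log (z - y)) ∂μ := by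
    refine integral_congr_ae ?_
    filter_upwards [H.ae_mem] with t ht
    exact Real.log_mul hu.ne' (by linarith [ht.2])
  rw [h1, integral_add (integrable_const _)
    (integrable_log_sub_of_le H.ae_mem H.pos H.stieltjes_le hz)]
  simp [logPotential]

/-- Covers both regimes of `v`: the argument of the logarithm factors as `u (z - y)` with `u =
2θ/β`. The two occurrences of `W` on the right cancel. -/
lemma sphericalLimit_of_vfun_eq (H : IsSpectralCurve μ r h q W) {β θ x z : ℝ} (hβ : 0 < β)
    (hθ : 0 < θ) (hz : r ≤ z) (hv : vfun β μ θ x = z - β / (2 * θ)) :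
    sphericalLimit β μ θ x = β / 2 * (profile μ W z (2 / β * θ) + W (2 / β * θ)) := by
  have h1 : ∀ y, 1 + 2 / β * θ * (z - β / (2 * θ)) - 2 / β * θ * y = 2 / β * θ * (z - y) := by
    intro y
    field_simp
    ring
  rw [sphericalLimit, hv]
  simp only [h1]
  rw [H.integral_log_mul_sub hz (by positivity), profile]
  field_simp
  ring

lemma sphericalLimit_of_le (H : IsSpectralCurve μ r h q W) {β θ x : ℝ} (hβ : 0 < β)
    (hθ : 0 < θ) (hx : r ≤ x) (hu : 2 / β * θ ≤ h x) :
    sphericalLimit β μ θ x = β / 2 * W (2 / β * θ) := by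
  have hpos : 0 < 2 / β * θ := by positivity
  obtain ⟨z, hz, hzu⟩ := H.exists_lower_eq hx hpos hu
  have hrz := hx.trans hz
  have hv : vfun β μ θ x = z - β / (2 * θ) := by
    rw [vfun, H.Hmax_eq hx, if_pos (EReal.coe_le_coe_iff.2 hu), Rtransform, if_neg hpos.ne', ← hzu,
      H.stieltjesInv_lower hrz, hzu]
    field_simp
  rw [H.sphericalLimit_of_vfun_eq hβ hθ hrz hv, ← hzu, H.profile_lower_eq_zero hrz, zero_add]

lemma sphericalLimit_of_lt (H : IsSpectralCurve μ r h q W) {β θ x : ℝ} (hβ : 0 < β)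
    (hθ : 0 < θ) (hx : r ≤ x) (hu : h x < 2 / β * θ) :
    sphericalLimit β μ θ x = β / 2 * (profile μ W x (2 / β * θ) + W (2 / β * θ)) := by
  refine H.sphericalLimit_of_vfun_eq hβ hθ hx ?_
  rw [vfun, H.Hmax_eq hx, if_neg (not_le.2 (EReal.coe_lt_coe_iff.2 hu))]

lemma profile_upper_nonneg (H : IsSpectralCurve μ r h q W) {x : ℝ} (hx : r ≤ x) :
    0 ≤ profile μ W x (q x) := by
  rw [H.profile_upper_eq_integral hx]
  refine intervalIntegral.integral_nonneg hx fun y hy => sub_nonneg.2 ?_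
  have h1 : h y ≤ h r := H.lower_strictAntiOn.antitoneOn self_mem_Ici hy.1 hy.1
  have h2 : q r ≤ q y := H.upper_monotoneOn self_mem_Ici hy.1 hy.1
  rw [H.edge_eq] at h2
  exact h1.trans h2

/-- The variational formula: the supremum over `θ` is the integral of the gap between branches. -/
theorem iSup_sphericalLimit_sub (H : IsSpectralCurve μ r h q W) {β x : ℝ} (hβ : 0 < β)
    (hx : r ≤ x) :
    ⨆ θ : {θ : ℝ // 0 ≤ θ}, ((sphericalLimit β μ θ x - β / 2 * W (2 / β * θ) : ℝ) : EReal) =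
      ((β / 2 * ∫ y in r..x, (q y - h y) : ℝ) : EReal) := by
  rw [← H.profile_upper_eq_integral hx]
  have hzero : ∀ θ : ℝ, 0 < θ → 2 / β * θ ≤ h x →
      sphericalLimit β μ θ x - β / 2 * W (2 / β * θ) = 0 := fun θ hθ hu => by
    rw [H.sphericalLimit_of_le hβ hθ hx hu, sub_self]
  have hprof : ∀ θ : ℝ, 0 < θ → h x < 2 / β * θ →
      sphericalLimit β μ θ x - β / 2 * W (2 / β * θ) = β / 2 * profile μ W x (2 / β * θ) :=
    fun θ hθ hu => by
      rw [H.sphericalLimit_of_lt hβ hθ hx hu]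
      ring
  have hnn := mul_nonneg (half_pos hβ).le (H.profile_upper_nonneg hx)
  apply le_antisymm
  · refine iSup_le fun ⟨θ, hθ⟩ => EReal.coe_le_coe_iff.2 ?_
    simp only
    rcases hθ.eq_or_lt with rfl | hθ
    -- At `θ = 0` the logarithm is of `1` and `W 0 = 0`, so the difference is zero.
    · simpa [sphericalLimit, H.W_zero] using hnn
    · rcases le_or_gt (2 / β * θ) (h x) with hu | hu
      · rw [hzero θ hθ hu]
        exact hnn
      · rw [hprof θ hθ hu]
        exact mul_le_mul_of_nonneg_left (H.profile_le hx hu) (half_pos hβ).le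
  -- The optimal `θ` corresponds to `u = q x`.
  · have hpos : 0 < β / 2 * q x := mul_pos (half_pos hβ) (H.upper_pos hx)
    refine le_iSup_of_le ⟨β / 2 * q x, hpos.le⟩ (EReal.coe_le_coe_iff.2 (le_of_eq ?_))
    have hq : 2 / β * (β / 2 * q x) = q x := by field_simp
    simp only
    rcases hx.eq_or_lt with rfl | hx'
    -- At `x = r` this `u` equals `h r` and belongs to the first regime; both sides are zero.
    · rw [hzero _ hpos (by rw [hq, H.edge_eq]), H.edge_eq, H.profile_lower_eq_zero le_rfl, mul_zero]
    · have hlt : h x < q x := by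
        have h1 := H.lower_strictAntiOn self_mem_Ici hx hx'
        have h2 := H.upper_monotoneOn self_mem_Ici hx hx
        rw [H.edge_eq] at h2
        exact h1.trans_le h2
      rw [hprof _ hpos (by rwa [hq]), hq]

end IsSpectralCurve

/-! ### Measures given by a density on an interval -/

/-- The end points are Lebesgue-null. Openness keeps `z - t` positive even when `z` is the edge. -/
lemma ae_mem_Ioo_withDensity (a b : ℝ) (f : ℝ → ENNReal) :
    ∀ᵐ x ∂((volume.restrict (Icc a b)).withDensity f), x ∈ Ioo a b := by
  refine (withDensity_absolutelyContinuous _ _).ae_le ?_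
  rw [← restrict_Ioo_eq_restrict_Icc]
  exact ae_restrict_mem measurableSet_Ioo

lemma integral_withDensity_Icc {a b : ℝ} (hab : a ≤ b) {f : ℝ → ℝ} (hf : Measurable f)
    (hf0 : ∀ x ∈ Ioo a b, 0 ≤ f x) (g : ℝ → ℝ) :
    ∫ x, g x ∂((volume.restrict (Icc a b)).withDensity fun x => ENNReal.ofReal (f x)) =
      ∫ x in a..b, f x * g x := by
  rw [integral_withDensity_eq_integral_toReal_smul hf.ennreal_ofReal
    (Eventually.of_forall fun _ => ENNReal.ofReal_lt_top), intervalIntegral.integral_of_le hab,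
    ← restrict_Ioo_eq_restrict_Icc, ← restrict_Ioo_eq_restrict_Ioc]
  refine setIntegral_congr_fun measurableSet_Ioo fun x hx => ?_
  simp [ENNReal.toReal_ofReal (hf0 x hx)]

lemma isProbabilityMeasure_withDensity_Icc {a b : ℝ} (hab : a ≤ b) {f : ℝ → ℝ}
    (hf0 : ∀ x ∈ Ioo a b, 0 ≤ f x) (hint : ∫ x in a..b, f x = 1) :
    IsProbabilityMeasure
      ((volume.restrict (Icc a b)).withDensity fun x => ENNReal.ofReal (f x)) := by
  constructor
  rw [withDensity_apply _ MeasurableSet.univ, Measure.restrict_univ,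
    ← restrict_Ioo_eq_restrict_Icc]
  rw [intervalIntegral.integral_of_le hab, ← restrict_Ioo_eq_restrict_Ioc] at hint
  have hi : IntegrableOn f (Ioo a b) := by
    -- A non-integrable function has integral `0`, not `1`.
    by_contra hcon
    rw [integral_undef hcon] at hint
    exact zero_ne_one hint
  rw [← ofReal_integral_eq_lintegral_ofReal hi (ae_restrict_of_forall_mem measurableSet_Ioo hf0),
    hint, ENNReal.ofReal_one]

lemma right_mem_support_withDensity_Icc {a b : ℝ} (hab : a < b) {f : ℝ → ℝ} (hf : Measurable f)
    (hf0 : ∀ x ∈ Ioo a b, 0 < f x) :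
    b ∈ ((volume.restrict (Icc a b)).withDensity fun x => ENNReal.ofReal (f x)).support := by
  rw [Measure.mem_support_iff_forall]
  intro U hU
  obtain ⟨l, hl, hlU⟩ := exists_Ioc_subset_of_mem_nhds hU ⟨a, hab⟩
  rw [pos_iff_ne_zero, Ne, withDensity_apply_eq_zero hf.ennreal_ofReal]
  have hsub : Ioo (max a l) b ⊆ {x | ENNReal.ofReal (f x) ≠ 0} ∩ U := by
    intro x hx
    have hx1 : a < x := (le_max_left _ _).trans_lt hx.1
    have hx2 : l < x := (le_max_right _ _).trans_lt hx.1
    exact ⟨(ENNReal.ofReal_pos.2 (hf0 x ⟨hx1, hx.2⟩)).ne', hlU ⟨hx2, hx.2.le⟩⟩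
  have hpos : 0 < (volume.restrict (Icc a b)) (Ioo (max a l) b) := by
    rw [Measure.restrict_apply measurableSet_Ioo, inter_eq_left.2, Real.volume_Ioo,
      ENNReal.ofReal_pos, sub_pos]
    · exact max_lt hab hl
    · exact fun x hx => ⟨(le_max_left _ _).trans hx.1.le, hx.2.le⟩
  exact (hpos.trans_le (measure_mono hsub)).ne'

/-! ### The Stieltjes transform of a semicircle -/

/-- The antiderivative comes from `1 - t² = (A - t)(A + t) - (A² - 1)` after dividing by `(A - t)√(1
- t²)`. At `A = 1` the quotient inside the second arcsine is discontinuous at `t = 1`, but its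
coefficient is zero; hence the case splits. -/
lemma integral_sqrt_one_sub_sq_div {A : ℝ} (hA : 1 ≤ A) :
    ∫ t in (-1 : ℝ)..1, √(1 - t ^ 2) / (A - t) = Real.pi * (A - √(A ^ 2 - 1)) := by
  set F : ℝ → ℝ := fun t => -√(1 - t ^ 2) + A * Real.arcsin t
    - √(A ^ 2 - 1) * Real.arcsin ((A * t - 1) / (A - t)) with hF
  have hcont : ContinuousOn F (Icc (-1) 1) := by
    have h1 : ContinuousOn (fun t : ℝ => -√(1 - t ^ 2) + A * Real.arcsin t) (Icc (-1) 1) :=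
      (Continuous.neg (by fun_prop)).continuousOn.add
        (continuous_const.mul Real.continuous_arcsin).continuousOn
    refine h1.sub ?_
    rcases hA.eq_or_lt with rfl | hA
    · simpa using continuousOn_const
    · refine continuousOn_const.mul (Real.continuous_arcsin.comp_continuousOn ?_)
      exact ContinuousOn.div (by fun_prop) (by fun_prop) fun t ht => by linarith [ht.2]
  have hderiv : ∀ t ∈ Ioo (-1 : ℝ) 1, HasDerivAt F (√(1 - t ^ 2) / (A - t)) t := by
    intro t ht
    have h1 : 0 < 1 - t ^ 2 := by nlinarith [ht.1, ht.2]
    have hAt : 0 < A - t := by linarith [ht.2]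
    have hs : 0 < √(1 - t ^ 2) := Real.sqrt_pos.2 h1
    have hss : √(1 - t ^ 2) ^ 2 = 1 - t ^ 2 := Real.sq_sqrt h1.le
    have d1 : HasDerivAt (fun t : ℝ => √(1 - t ^ 2)) (-(2 * t) / (2 * √(1 - t ^ 2))) t := by
      have := ((hasDerivAt_pow 2 t).const_sub 1).sqrt h1.ne'
      simpa using this
    have d2 : HasDerivAt (fun t : ℝ => A * Real.arcsin t) (A * (1 / √(1 - t ^ 2))) t :=
      (Real.hasDerivAt_arcsin (by linarith [ht.1]) (by linarith [ht.2])).const_mul A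
    rcases hA.eq_or_lt with rfl | hA
    · have := d1.neg.add d2
      have hFe : F = fun t => -√(1 - t ^ 2) + 1 * Real.arcsin t := by
        funext t; simp [hF]
      rw [hFe]
      refine this.congr_deriv ?_
      field_simp
      linear_combination -hss
    · have hA1 : 0 < A ^ 2 - 1 := by nlinarith
      have hc : 0 < √(A ^ 2 - 1) := Real.sqrt_pos.2 hA1
      have hcc : √(A ^ 2 - 1) ^ 2 = A ^ 2 - 1 := Real.sq_sqrt hA1.le
      have d3 : HasDerivAt (fun t : ℝ => (A * t - 1) / (A - t)) ((A ^ 2 - 1) / (A - t) ^ 2) t := by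
        have := (((hasDerivAt_id t).const_mul A).sub_const 1).div
          ((hasDerivAt_id t).const_sub A) hAt.ne'
        refine this.congr_deriv ?_
        simp only [id]
        field_simp
        ring
      have hsq : 1 - ((A * t - 1) / (A - t)) ^ 2 =
          (√(A ^ 2 - 1) * √(1 - t ^ 2) / (A - t)) ^ 2 := by
        rw [div_pow, div_pow (_ * _), mul_pow, hss, hcc]
        field_simp
        ring
      have hprod : 0 < √(A ^ 2 - 1) * √(1 - t ^ 2) / (A - t) := by positivity
      have hlt : ((A * t - 1) / (A - t)) ^ 2 < 1 := by
        have : 0 < (√(A ^ 2 - 1) * √(1 - t ^ 2) / (A - t)) ^ 2 := by positivity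
        linarith
      have habs := abs_lt.1 ((sq_lt_one_iff_abs_lt_one _).1 hlt)
      have d4 := (Real.hasDerivAt_arcsin habs.1.ne' habs.2.ne).comp t d3
      rw [hsq, Real.sqrt_sq hprod.le] at d4
      have := (d1.neg.add d2).sub (d4.const_mul (√(A ^ 2 - 1)))
      refine this.congr_deriv ?_
      have hne : A - t ≠ 0 := hAt.ne'
      field_simp
      linear_combination (-1) * hss
  have hnn : ∀ t ∈ Ioo (-1 : ℝ) 1, 0 ≤ √(1 - t ^ 2) / (A - t) := fun t ht =>
    div_nonneg (Real.sqrt_nonneg _) (by linarith [ht.2])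
  have hle : (-1 : ℝ) ≤ 1 := by norm_num
  -- For `A = 1` the integrand is unbounded near `1`; integrability comes from being the nonnegative
  -- derivative of a continuous function.
  have hint : IntervalIntegrable (fun t => √(1 - t ^ 2) / (A - t)) volume (-1) 1 := by
    rw [intervalIntegrable_iff_integrableOn_Ioc_of_le hle]
    exact intervalIntegral.integrableOn_deriv_of_nonneg hcont hderiv hnn
  rw [intervalIntegral.integral_eq_sub_of_hasDerivAt_of_le hle hcont hderiv hint]
  have e2 : (A * (-1) - 1) / (A - -1) = -1 := by
    rw [div_eq_iff (by linarith)]; ring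
  rcases hA.eq_or_lt with rfl | hA
  · simp [hF]
  · have e1 : (A * 1 - 1) / (A - 1) = 1 := by
      rw [mul_one, div_self (by linarith)]
    simp only [hF, e1, e2, Real.arcsin_one, Real.arcsin_neg_one]
    norm_num
    ring

/-- Substitute `x = ρt + m`. Equality `w = m + ρ` is needed for the Pastur–Marchenko mass at `α =
1`. -/
lemma integral_sqrt_div_sub {m ρ w : ℝ} (hρ : 0 < ρ) (hw : m + ρ ≤ w) :
    ∫ x in (m - ρ)..(m + ρ), √((m + ρ - x) * (x - (m - ρ))) / (w - x) =
      Real.pi * (w - m - √((w - m) ^ 2 - ρ ^ 2)) := by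
  have hA : 1 ≤ (w - m) / ρ := by rw [le_div_iff₀ hρ]; linarith
  have h1 := intervalIntegral.integral_comp_mul_add (a := (-1 : ℝ)) (b := 1)
    (fun x => √((m + ρ - x) * (x - (m - ρ))) / (w - x)) hρ.ne' m
  have e1 : ρ * -1 + m = m - ρ := by ring
  have e2 : ρ * 1 + m = m + ρ := by ring
  have e3 : ∀ t : ℝ, √((m + ρ - (ρ * t + m)) * (ρ * t + m - (m - ρ))) / (w - (ρ * t + m)) =
      √(1 - t ^ 2) / ((w - m) / ρ - t) := by
    intro t
    have : (m + ρ - (ρ * t + m)) * (ρ * t + m - (m - ρ)) = ρ ^ 2 * (1 - t ^ 2) := by ring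
    rw [this, Real.sqrt_mul (sq_nonneg ρ), Real.sqrt_sq hρ.le]
    have : w - (ρ * t + m) = ρ * ((w - m) / ρ - t) := by field_simp; ring
    rw [this, mul_div_mul_left _ _ hρ.ne']
  rw [e1, e2] at h1
  simp only [e3] at h1
  rw [integral_sqrt_one_sub_sq_div hA, eq_inv_smul_iff₀ hρ.ne', smul_eq_mul] at h1
  rw [← h1]
  have e4 : ((w - m) / ρ) ^ 2 - 1 = ((w - m) ^ 2 - ρ ^ 2) / ρ ^ 2 := by field_simp
  rw [e4, Real.sqrt_div' _ (sq_nonneg ρ), Real.sqrt_sq hρ.le]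
  field_simp

/-! ### The semicircle law -/

lemma measurable_semicircle_density :
    Measurable fun x : ℝ => 1 / (2 * Real.pi) * √(4 - x ^ 2) := by fun_prop

lemma semicircle_density_pos {x : ℝ} (hx : x ∈ Ioo (-2 : ℝ) 2) :
    0 < 1 / (2 * Real.pi) * √(4 - x ^ 2) := by
  have : 0 < 4 - x ^ 2 := by nlinarith [hx.1, hx.2]
  have := Real.pi_pos
  positivity

lemma integral_semicircle (g : ℝ → ℝ) :
    ∫ x, g x ∂semicircle = ∫ x in (-2 : ℝ)..2, 1 / (2 * Real.pi) * √(4 - x ^ 2) * g x :=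
  integral_withDensity_Icc (by norm_num) measurable_semicircle_density
    (fun _ hx => (semicircle_density_pos hx).le) g

instance isProbabilityMeasure_semicircle : IsProbabilityMeasure semicircle := by
  refine isProbabilityMeasure_withDensity_Icc (by norm_num)
    (fun _ hx => (semicircle_density_pos hx).le) ?_
  have h1 := intervalIntegral.integral_comp_mul_left (a := (-1 : ℝ)) (b := 1)
    (fun x => √(4 - x ^ 2)) (two_ne_zero (α := ℝ))
  have e : ∀ t : ℝ, √(4 - (2 * t) ^ 2) = 2 * √(1 - t ^ 2) := by
    intro t
    have : 4 - (2 * t) ^ 2 = 2 ^ 2 * (1 - t ^ 2) := by ring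
    rw [this, Real.sqrt_mul (by norm_num), Real.sqrt_sq (by norm_num)]
  simp only [e, intervalIntegral.integral_const_mul, integral_sqrt_one_sub_sq, smul_eq_mul] at h1
  norm_num at h1
  rw [intervalIntegral.integral_const_mul]
  have hpi := Real.pi_pos
  field_simp
  linarith

lemma stieltjes_semicircle {z : ℝ} (hz : 2 < z) :
    stieltjes semicircle z = (z - √(z ^ 2 - 4)) / 2 := by
  rw [stieltjes, integral_semicircle]
  have h := integral_sqrt_div_sub (m := 0) (ρ := 2) (w := z) two_pos (by linarith)
  simp only [zero_add, zero_sub, sub_zero] at h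
  have e : ∀ x : ℝ, 1 / (2 * Real.pi) * √(4 - x ^ 2) * (1 / (z - x)) =
      1 / (2 * Real.pi) * (√((2 - x) * (x - -2)) / (z - x)) := by
    intro x
    rw [show (2 - x) * (x - -2) = 4 - x ^ 2 by ring]
    ring
  simp only [e, intervalIntegral.integral_const_mul]
  rw [h]
  have hpi := Real.pi_pos
  norm_num
  field_simp

/-- The spectral curve `u + 1/u = z` of the semicircle law. -/
theorem isSpectralCurve_semicircle :
    IsSpectralCurve semicircle 2 (fun z => (z - √(z ^ 2 - 4)) / 2)
      (fun z => (z + √(z ^ 2 - 4)) / 2) (fun u => u ^ 2 / 2) := by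
  have hD : ∀ z : ℝ, 2 < z → HasDerivAt (fun z : ℝ => √(z ^ 2 - 4)) (z / √(z ^ 2 - 4)) z := by
    intro z hz
    have h0 : z ^ 2 - 4 ≠ 0 := by nlinarith
    refine (((hasDerivAt_pow 2 z).sub_const 4).sqrt h0).congr_deriv ?_
    norm_num
    exact mul_div_mul_left _ _ two_ne_zero
  refine
    { pos := two_pos
      ae_mem := ae_mem_Ioo_withDensity _ _ _
      mem_support := right_mem_support_withDensity_Icc (by norm_num)
        measurable_semicircle_density fun _ hx => semicircle_density_pos hx
      stieltjes_eq := fun z hz => stieltjes_semicircle hz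
      continuousOn_lower := Continuous.continuousOn (by fun_prop)
      continuousOn_upper := Continuous.continuousOn (by fun_prop)
      edge_eq := by norm_num
      tendsto_upper := ?_
      W_zero := by norm_num
      continuousAt_W := Continuous.continuousAt (by fun_prop)
      continuousOn_W_lower := Continuous.continuousOn (by fun_prop)
      continuousOn_W_upper := Continuous.continuousOn (by fun_prop)
      lower_deriv := ?_
      upper_deriv := ?_ }
  · refine tendsto_atTop_mono (fun z => ?_) (tendsto_id.atTop_div_const (two_pos (α := ℝ)))
    have := Real.sqrt_nonneg (z ^ 2 - 4)
    simp only [id]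
    linarith
  · intro z hz
    have h0 : 0 < z ^ 2 - 4 := by nlinarith
    have hs : 0 < √(z ^ 2 - 4) := Real.sqrt_pos.2 h0
    have hss : √(z ^ 2 - 4) ^ 2 = z ^ 2 - 4 := Real.sq_sqrt h0.le
    have hd := ((hasDerivAt_id z).sub (hD z hz)).div_const 2
    refine ⟨_, hd, ((hd.pow 2).div_const 2).congr_deriv ?_⟩
    have hne : z - √(z ^ 2 - 4) ≠ 0 := by
      intro hcon
      nlinarith
    -- The curve `u + 1/u = z` says that `z - 1/u = u`, the derivative of `u²/2`.
    have e : z - 1 / ((z - √(z ^ 2 - 4)) / 2) = (z - √(z ^ 2 - 4)) / 2 := by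
      field_simp
      linear_combination -hss
    rw [e]
    simp only [Pi.sub_apply, id]
    ring
  · intro z hz
    have h0 : 0 < z ^ 2 - 4 := by nlinarith
    have hs : 0 < √(z ^ 2 - 4) := Real.sqrt_pos.2 h0
    have hss : √(z ^ 2 - 4) ^ 2 = z ^ 2 - 4 := Real.sq_sqrt h0.le
    have hd := ((hasDerivAt_id z).add (hD z hz)).div_const 2
    refine ⟨_, by positivity, hd, ((hd.pow 2).div_const 2).congr_deriv ?_⟩
    have hne : z + √(z ^ 2 - 4) ≠ 0 := by positivity
    have e : z - 1 / ((z + √(z ^ 2 - 4)) / 2) = (z + √(z ^ 2 - 4)) / 2 := by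
      field_simp
      linear_combination -hss
    rw [e]
    simp only [Pi.add_apply, id]
    ring

theorem wignerRate_eq_iSup {b x : ℝ} (hb : 0 < b) (hx : rightEdge semicircle ≤ x) :
    wignerRate b x = ⨆ θ : {θ : ℝ // 0 ≤ θ},
      ((sphericalLimit b semicircle θ x - wignerF b θ : ℝ) : EReal) := by
  rw [isSpectralCurve_semicircle.rightEdge_eq] at hx
  have hF : ∀ θ : ℝ, wignerF b θ = b / 2 * ((2 / b * θ) ^ 2 / 2) := by
    intro θ
    rw [wignerF]
    field_simp
  simp only [hF]
  rw [isSpectralCurve_semicircle.iSup_sphericalLimit_sub hb hx, wignerRate, if_neg (not_lt.2 hx)]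
  congr 3
  funext y
  ring

/-! ### The Pastur–Marchenko law -/

section MarchenkoPastur

variable {α : ℝ}

lemma mpLower_eq (hα : 1 ≤ α) : mpLower α = 1 + α - 2 * √α := by
  have := Real.sq_sqrt (zero_le_one.trans hα)
  rw [mpLower]
  linear_combination this

lemma mpUpper_eq (hα : 1 ≤ α) : mpUpper α = 1 + α + 2 * √α := by
  have := Real.sq_sqrt (zero_le_one.trans hα)
  rw [mpUpper]
  linear_combination this

lemma mpLower_lt_mpUpper (hα : 1 ≤ α) : mpLower α < mpUpper α := by
  have : 0 < √α := Real.sqrt_pos.2 (by linarith)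
  rw [mpLower_eq hα, mpUpper_eq hα]
  linarith

lemma measurable_marchenkoPastur_density (α : ℝ) :
    Measurable fun x : ℝ => √((mpUpper α - x) * (x - mpLower α)) / (2 * Real.pi * x) :=
  Measurable.div (by fun_prop) (by fun_prop)

lemma marchenkoPastur_density_pos {x : ℝ} (hx : x ∈ Ioo (mpLower α) (mpUpper α)) :
    0 < √((mpUpper α - x) * (x - mpLower α)) / (2 * Real.pi * x) := by
  have h0 : 0 < x := (sq_nonneg (1 - √α)).trans_lt hx.1
  have h1 : 0 < (mpUpper α - x) * (x - mpLower α) :=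
    mul_pos (by linarith [hx.2]) (by linarith [hx.1])
  have := Real.pi_pos
  positivity

lemma integral_marchenkoPastur (hα : 1 ≤ α) (g : ℝ → ℝ) :
    ∫ x, g x ∂(marchenkoPastur α) = ∫ x in (mpLower α)..(mpUpper α),
      √((mpUpper α - x) * (x - mpLower α)) / (2 * Real.pi * x) * g x :=
  integral_withDensity_Icc (mpLower_lt_mpUpper hα).le (measurable_marchenkoPastur_density α)
    (fun _ hx => (marchenkoPastur_density_pos hx).le) g

/-- After `x ↦ -x` this is the semicircle integral evaluated at `w = 0`. -/
lemma integral_sqrt_mp_div (hα : 1 ≤ α) :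
    ∫ x in (mpLower α)..(mpUpper α), √((mpUpper α - x) * (x - mpLower α)) / x =
      2 * Real.pi := by
  have hs : 0 < √α := Real.sqrt_pos.2 (by linarith)
  have hss := Real.sq_sqrt (zero_le_one.trans hα)
  have h0 : 0 ≤ mpLower α := sq_nonneg _
  rw [mpLower_eq hα] at h0
  have h := integral_sqrt_div_sub (m := -(1 + α)) (ρ := 2 * √α) (w := 0) (by positivity)
    (by linarith)
  have e : (0 - -(1 + α)) ^ 2 - (2 * √α) ^ 2 = (α - 1) ^ 2 := by linear_combination (-4) * hss
  rw [e, Real.sqrt_sq (by linarith)] at h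
  have hn := intervalIntegral.integral_comp_neg (a := mpLower α) (b := mpUpper α)
    (fun x => √((-(1 + α) + 2 * √α - x) * (x - (-(1 + α) - 2 * √α))) / (0 - x))
  rw [show -mpUpper α = -(1 + α) - 2 * √α by rw [mpUpper_eq hα]; ring,
    show -mpLower α = -(1 + α) + 2 * √α by rw [mpLower_eq hα]; ring, h] at hn
  rw [show 2 * Real.pi = Real.pi * (0 - -(1 + α) - (α - 1)) by ring, ← hn]
  congr 1
  funext x
  rw [mpUpper_eq hα, mpLower_eq hα]
  congr 2 <;> ring

lemma isProbabilityMeasure_marchenkoPastur (hα : 1 ≤ α) :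
    IsProbabilityMeasure (marchenkoPastur α) := by
  refine isProbabilityMeasure_withDensity_Icc (mpLower_lt_mpUpper hα).le
    (fun _ hx => (marchenkoPastur_density_pos hx).le) ?_
  have e : ∀ x, √((mpUpper α - x) * (x - mpLower α)) / (2 * Real.pi * x) =
      1 / (2 * Real.pi) * (√((mpUpper α - x) * (x - mpLower α)) / x) := fun x => by
    rw [div_mul_div_comm, one_mul]
  simp only [e]
  rw [intervalIntegral.integral_const_mul, integral_sqrt_mp_div hα]
  have := Real.pi_pos
  field_simp

/-- Partial fractions: `1/(x(w - x)) = (1/x + 1/(w - x))/w`. -/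
lemma integral_one_div_sub_marchenkoPastur (hα : 1 ≤ α) {w : ℝ} (hw : mpUpper α < w) :
    ∫ x, 1 / (w - x) ∂(marchenkoPastur α) =
      (w + 1 - α - √((w - (1 + α)) ^ 2 - 4 * α)) / (2 * w) := by
  have hs : 0 < √α := Real.sqrt_pos.2 (by linarith)
  have hss := Real.sq_sqrt (zero_le_one.trans hα)
  have hab := mpLower_lt_mpUpper hα
  have hw0 : 0 < w := ((sq_nonneg (1 - √α)).trans_lt hab).trans hw
  have hpi := Real.pi_pos
  have h1 := integral_sqrt_mp_div hα
  have h2 := integral_sqrt_div_sub (m := 1 + α) (ρ := 2 * √α) (w := w) (by positivity)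
    (by rw [← mpUpper_eq hα]; exact hw.le)
  rw [← mpUpper_eq hα, ← mpLower_eq hα, show (2 * √α) ^ 2 = 4 * α by linear_combination 4 * hss]
    at h2
  -- At `α = 1` the integrand is singular at `0`; integrability follows from its integral being
  -- nonzero.
  have i1 : IntervalIntegrable (fun x => √((mpUpper α - x) * (x - mpLower α)) / x) volume
      (mpLower α) (mpUpper α) := by
    by_contra hcon
    rw [intervalIntegral.integral_undef hcon] at h1
    linarith
  have i2 : IntervalIntegrable (fun x => √((mpUpper α - x) * (x - mpLower α)) / (w - x)) volume
      (mpLower α) (mpUpper α) := by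
    refine ContinuousOn.intervalIntegrable ?_
    rw [uIcc_of_le hab.le]
    exact ContinuousOn.div (by fun_prop) (by fun_prop) fun x hx => by linarith [hx.2]
  rw [integral_marchenkoPastur hα]
  have e : ∫ x in (mpLower α)..(mpUpper α),
        √((mpUpper α - x) * (x - mpLower α)) / (2 * Real.pi * x) * (1 / (w - x)) =
      ∫ x in (mpLower α)..(mpUpper α), 1 / (2 * Real.pi * w) *
        (√((mpUpper α - x) * (x - mpLower α)) / x +
          √((mpUpper α - x) * (x - mpLower α)) / (w - x)) := by
    rw [intervalIntegral.integral_of_le hab.le, intervalIntegral.integral_of_le hab.le]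
    refine setIntegral_congr_fun measurableSet_Ioc fun x hx => ?_
    have hx0 : x ≠ 0 := ((sq_nonneg (1 - √α)).trans_lt hx.1).ne'
    have hwx : w - x ≠ 0 := by linarith [hx.2]
    field_simp
    ring
  rw [e, intervalIntegral.integral_const_mul, intervalIntegral.integral_add i1 i2, h1, h2]
  field_simp
  ring

end MarchenkoPastur

/-! ### The law `σ_w` -/

section Wishart

variable {α : ℝ}

lemma wishartEdge_eq (α : ℝ) : wishartEdge α = √(mpUpper α / (1 + α)) := by
  rw [wishartEdge, mul_comm, div_eq_mul_inv]

lemma wishartEdge_sq (hα : 1 ≤ α) : (1 + α) * wishartEdge α ^ 2 = mpUpper α := by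
  have h1 : 0 ≤ mpUpper α := sq_nonneg _
  rw [wishartEdge_eq α, Real.sq_sqrt (by positivity)]
  field_simp

lemma wishartEdge_pos (hα : 1 ≤ α) : 0 < wishartEdge α := by
  have h1 : 0 < 1 + √α := by positivity
  have h2 : 0 < 1 + α := by linarith
  have h3 : 0 < mpUpper α := by unfold mpUpper; positivity
  rw [wishartEdge_eq α]
  positivity

lemma measurable_sqrt_div (α : ℝ) : Measurable fun x : ℝ => √(x / (1 + α)) := by fun_prop

lemma measurable_neg_sqrt_div (α : ℝ) : Measurable fun x : ℝ => -√(x / (1 + α)) := by fun_prop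

lemma ae_mem_marchenkoPastur (α : ℝ) :
    ∀ᵐ x ∂(marchenkoPastur α), x ∈ Ioo (mpLower α) (mpUpper α) :=
  ae_mem_Ioo_withDensity _ _ _

lemma ae_sqrt_div_mem_marchenkoPastur (hα : 1 ≤ α) :
    ∀ᵐ x ∂(marchenkoPastur α), √(x / (1 + α)) ∈ Ico 0 (wishartEdge α) := by
  filter_upwards [ae_mem_marchenkoPastur α] with x hx
  have h0 : 0 < x := (sq_nonneg (1 - √α)).trans_lt hx.1
  refine ⟨Real.sqrt_nonneg _, ?_⟩
  rw [wishartEdge_eq α]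
  exact Real.sqrt_lt_sqrt (by positivity) (div_lt_div_of_pos_right hx.2 (by linarith))

lemma isProbabilityMeasure_wishartLaw (hα : 1 ≤ α) : IsProbabilityMeasure (wishartLaw α) := by
  have := isProbabilityMeasure_marchenkoPastur hα
  have h1 := Measure.isProbabilityMeasure_map (μ := marchenkoPastur α)
    (measurable_sqrt_div α).aemeasurable
  have h2 := Measure.isProbabilityMeasure_map (μ := marchenkoPastur α)
    (measurable_neg_sqrt_div α).aemeasurable
  constructor
  have e1 : ((marchenkoPastur α).map fun x => √(x / (1 + α))) univ = 1 := measure_univ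
  have e2 : ((marchenkoPastur α).map fun x => -√(x / (1 + α))) univ = 1 := h2.measure_univ
  have hpos : 0 < 1 + α := by linarith
  simp only [wishartLaw, Measure.add_apply, Measure.smul_apply, e1, e2, smul_eq_mul, measure_univ,
    mul_one]
  rw [mul_add, mul_one, ← ENNReal.ofReal_add (by positivity) (by positivity),
    ← ENNReal.ofReal_add (by positivity) (div_nonneg (by linarith) (by linarith)),
    ← ENNReal.ofReal_one]
  congr 1
  field_simp
  ring

lemma ae_mem_wishartLaw (hα : 1 ≤ α) :
    ∀ᵐ t ∂(wishartLaw α), t ∈ Ioo (-wishartEdge α) (wishartEdge α) := by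
  have hpos := wishartEdge_pos hα
  have hmp := ae_sqrt_div_mem_marchenkoPastur hα
  rw [wishartLaw, ae_add_measure_iff]
  refine ⟨?_, ?_⟩
  · refine Measure.ae_smul_measure ?_ _
    rw [ae_add_measure_iff,
      ae_map_iff (p := (· ∈ Ioo (-wishartEdge α) (wishartEdge α)))
        (measurable_sqrt_div α).aemeasurable measurableSet_Ioo,
      ae_map_iff (p := (· ∈ Ioo (-wishartEdge α) (wishartEdge α)))
        (measurable_neg_sqrt_div α).aemeasurable measurableSet_Ioo]
    refine ⟨?_, ?_⟩ <;> filter_upwards [hmp] with x hx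
    · exact ⟨by linarith [hx.1], hx.2⟩
    · exact ⟨by linarith [hx.2], by linarith [hx.1]⟩
  · refine Measure.ae_smul_measure ?_ _
    rw [ae_dirac_iff (p := (· ∈ Ioo (-wishartEdge α) (wishartEdge α))) measurableSet_Ioo]
    exact ⟨by linarith, hpos⟩

lemma wishartEdge_mem_support (hα : 1 ≤ α) : wishartEdge α ∈ (wishartLaw α).support := by
  rw [Measure.mem_support_iff_forall]
  intro U hU
  obtain ⟨V, hVU, hV, hmem⟩ := mem_nhds_iff.1 hU
  refine lt_of_lt_of_le ?_ (measure_mono hVU)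
  have hpre : (fun x : ℝ => √(x / (1 + α))) ⁻¹' V ∈ 𝓝 (mpUpper α) := by
    refine ContinuousAt.preimage_mem_nhds (by fun_prop) ?_
    rw [← wishartEdge_eq α]
    exact hV.mem_nhds hmem
  have hsupp : mpUpper α ∈ (marchenkoPastur α).support :=
    right_mem_support_withDensity_Icc (mpLower_lt_mpUpper hα)
      (measurable_marchenkoPastur_density α) fun _ hx => marchenkoPastur_density_pos hx
  have hlt := (Measure.mem_support_iff_forall _).1 hsupp _ hpre
  rw [← Measure.map_apply (measurable_sqrt_div α) hV.measurableSet] at hlt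
  have hc : 0 < ENNReal.ofReal (1 / (1 + α)) := ENNReal.ofReal_pos.2 (by positivity)
  simp only [wishartLaw, Measure.add_apply, Measure.smul_apply, smul_eq_mul]
  refine lt_of_lt_of_le (ENNReal.mul_pos hc.ne' ?_) le_self_add
  exact (lt_of_lt_of_le hlt le_self_add).ne'

/-- Half the gap between the two branches of the spectral curve of `σ_w`. -/
noncomputable def wishartGap (α y : ℝ) : ℝ :=
  √((1 + α) ^ 2 * (y ^ 2 - 1) ^ 2 - 4 * α) / ((1 + α) * y)

/-- Pairing `±s` gives `2z/(z² - s²)`, hence the Pastur–Marchenko transform at `(1 + α)z²`. Its term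
`-(α - 1)/((1 + α)z)` cancels the atom at `0`. -/
lemma stieltjes_wishartLaw (hα : 1 ≤ α) {z : ℝ} (hz : wishartEdge α < z) :
    stieltjes (wishartLaw α) z = z - wishartGap α z := by
  have hmp := isProbabilityMeasure_marchenkoPastur hα
  have hz0 : 0 < z := (wishartEdge_pos hα).trans hz
  have hα0 : 0 < 1 + α := by linarith
  have hw : mpUpper α < (1 + α) * z ^ 2 := by
    rw [← wishartEdge_sq hα]
    have := wishartEdge_pos hα
    gcongr
  have hae := ae_mem_marchenkoPastur α
  have hbd := ae_sqrt_div_mem_marchenkoPastur hα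
  have hm := measurable_one_div_sub z
  have i1 : Integrable (fun x => 1 / (z - √(x / (1 + α)))) (marchenkoPastur α) := by
    refine Integrable.of_bound (C := 1 / (z - wishartEdge α))
      (hm.comp (measurable_sqrt_div α)).aestronglyMeasurable ?_
    filter_upwards [hbd] with x hx
    rw [Real.norm_of_nonneg (one_div_nonneg.2 (by linarith [hx.2]))]
    exact one_div_le_one_div_of_le (by linarith) (by linarith [hx.2])
  have i2 : Integrable (fun x => 1 / (z - -√(x / (1 + α)))) (marchenkoPastur α) := by
    refine Integrable.of_bound (C := 1 / z)
      (hm.comp (measurable_neg_sqrt_div α)).aestronglyMeasurable ?_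
    filter_upwards [hbd] with x hx
    rw [Real.norm_of_nonneg (one_div_nonneg.2 (by linarith [hx.1]))]
    exact one_div_le_one_div_of_le hz0 (by linarith [hx.1])
  have j1 : Integrable (fun t => 1 / (z - t)) ((marchenkoPastur α).map fun x => √(x / (1 + α))) :=
    (integrable_map_measure hm.aestronglyMeasurable (measurable_sqrt_div α).aemeasurable).2 i1
  have j2 : Integrable (fun t => 1 / (z - t)) ((marchenkoPastur α).map fun x => -√(x / (1 + α))) :=
    (integrable_map_measure hm.aestronglyMeasurable (measurable_neg_sqrt_div α).aemeasurable).2 i2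
  have hsum : ∫ x, 1 / (z - √(x / (1 + α))) ∂(marchenkoPastur α)
      + ∫ x, 1 / (z - -√(x / (1 + α))) ∂(marchenkoPastur α) =
      2 * z * (1 + α) * ∫ x, 1 / ((1 + α) * z ^ 2 - x) ∂(marchenkoPastur α) := by
    rw [← integral_add i1 i2, ← integral_const_mul]
    refine integral_congr_ae ?_
    filter_upwards [hbd, hae] with x hx hx'
    have h0 : 0 < x := (sq_nonneg (1 - √α)).trans_lt hx'.1
    have hsq : √(x / (1 + α)) ^ 2 = x / (1 + α) := Real.sq_sqrt (by positivity)
    have hx2 : x = (1 + α) * √(x / (1 + α)) ^ 2 := by rw [hsq]; field_simp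
    have n1 : z - √(x / (1 + α)) ≠ 0 := by linarith [hx.2]
    have n2 : z + √(x / (1 + α)) ≠ 0 := by linarith [hx.1]
    have n3 : (1 + α) * z ^ 2 - x ≠ 0 := by linarith [hx'.2]
    have e3 : (1 + α) * z ^ 2 - x =
        (1 + α) * ((z - √(x / (1 + α))) * (z + √(x / (1 + α)))) := by
      linear_combination (-1) * hx2
    rw [e3, sub_neg_eq_add]
    field_simp
    ring
  have k2 : Integrable (fun t => 1 / (z - t))
      (ENNReal.ofReal ((α - 1) / (α + 1)) • Measure.dirac (0 : ℝ)) :=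
    (integrable_dirac (by simp)).smul_measure ENNReal.ofReal_ne_top
  rw [stieltjes, wishartLaw, integral_add_measure
    ((j1.add_measure j2).smul_measure ENNReal.ofReal_ne_top) k2, integral_smul_measure,
    integral_smul_measure, integral_add_measure j1 j2,
    integral_map (measurable_sqrt_div α).aemeasurable hm.aestronglyMeasurable,
    integral_map (measurable_neg_sqrt_div α).aemeasurable hm.aestronglyMeasurable,
    integral_dirac, hsum, integral_one_div_sub_marchenkoPastur hα hw,
    ENNReal.toReal_ofReal (by positivity),
    ENNReal.toReal_ofReal (div_nonneg (by linarith) (by linarith)), wishartGap]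
  rw [show ((1 + α) * z ^ 2 - (1 + α)) ^ 2 - 4 * α = (1 + α) ^ 2 * (z ^ 2 - 1) ^ 2 - 4 * α by ring]
  have : α + 1 ≠ 0 := by linarith
  simp only [smul_eq_mul, sub_zero]
  field_simp
  ring

end Wishart

/-! ### The variational function of the Wishart models -/

section WishartVariational

variable {α : ℝ}

/-- The function maximised over `s` in the definition of `F(θ, w_b)`, in the variable
`u = 2θ/b`. -/
noncomputable def wishartPhi (α u s : ℝ) : ℝ :=
  u ^ 2 * (s * (1 - s)) + 1 / (1 + α) * Real.log (1 - s) + α / (1 + α) * Real.log s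

/-- The normalised Legendre potential `(2/b) F(b u / 2, w_b)`. -/
noncomputable def wishartW (α u : ℝ) : ℝ :=
  sSup (wishartPhi α u '' Ioo 0 1) - wishartPhi α 0 (α / (1 + α))

/-- By concavity, a stationary point is a maximum. -/
lemma isGreatest_wishartPhi (hα : 1 ≤ α) {u s : ℝ} (hs : s ∈ Ioo (0 : ℝ) 1)
    (hstat : u ^ 2 * (1 - 2 * s) - 1 / (1 + α) / (1 - s) + α / (1 + α) / s = 0) :
    IsGreatest (wishartPhi α u '' Ioo 0 1) (wishartPhi α u s) := by
  refine ⟨mem_image_of_mem _ hs, ?_⟩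
  rintro _ ⟨t, ht, rfl⟩
  have hs0 := hs.1
  have hs1 : 0 < 1 - s := sub_pos.2 hs.2
  have ht1 : 0 < 1 - t := sub_pos.2 ht.2
  have l1 := Real.log_le_sub_one_of_pos (div_pos ht.1 hs0)
  have l2 := Real.log_le_sub_one_of_pos (div_pos ht1 hs1)
  rw [Real.log_div ht.1.ne' hs0.ne'] at l1
  rw [Real.log_div ht1.ne' hs1.ne'] at l2
  have c1 : 0 ≤ 1 / (1 + α) := by positivity
  have c2 : 0 ≤ α / (1 + α) := by positivity
  have m1 := mul_le_mul_of_nonneg_left l1 c2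
  have m2 := mul_le_mul_of_nonneg_left l2 c1
  have e1 : α / (1 + α) * (t / s - 1) = α / (1 + α) / s * (t - s) := by field_simp
  have e2 : 1 / (1 + α) * ((1 - t) / (1 - s) - 1) = -(1 / (1 + α) / (1 - s)) * (t - s) := by
    field_simp
    ring
  rw [e1] at m1
  rw [e2] at m2
  -- Each of the three terms lies below its tangent at `s`; by stationarity the slopes add up to
  -- zero.
  have m3 : u ^ 2 * (t * (1 - t)) ≤ u ^ 2 * (s * (1 - s)) + u ^ 2 * (1 - 2 * s) * (t - s) := by
    nlinarith [mul_nonneg (sq_nonneg u) (sq_nonneg (t - s))]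
  have m4 : (u ^ 2 * (1 - 2 * s) - 1 / (1 + α) / (1 - s) + α / (1 + α) / s) * (t - s) = 0 := by
    rw [hstat, zero_mul]
  unfold wishartPhi
  linarith

lemma wishartW_eq (hα : 1 ≤ α) {u s : ℝ} (hs : s ∈ Ioo (0 : ℝ) 1)
    (hstat : u ^ 2 * (1 - 2 * s) - 1 / (1 + α) / (1 - s) + α / (1 + α) / s = 0) :
    wishartW α u = wishartPhi α u s - wishartPhi α 0 (α / (1 + α)) := by
  rw [wishartW, (isGreatest_wishartPhi hα hs hstat).csSup_eq]

lemma ratio_mem_Ioo (hα : 1 ≤ α) : α / (1 + α) ∈ Ioo (0 : ℝ) 1 :=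
  ⟨by positivity, by rw [div_lt_one (by linarith)]; linarith⟩

lemma isGreatest_wishartPhi_zero (hα : 1 ≤ α) :
    IsGreatest (wishartPhi α 0 '' Ioo 0 1) (wishartPhi α 0 (α / (1 + α))) := by
  refine isGreatest_wishartPhi hα (ratio_mem_Ioo hα) ?_
  have h1 : 0 < 1 + α := by linarith
  have h2 : 1 - α / (1 + α) = 1 / (1 + α) := by field_simp; ring
  rw [h2]
  field_simp
  ring

lemma wishartW_zero (hα : 1 ≤ α) : wishartW α 0 = 0 := by
  rw [wishartW, (isGreatest_wishartPhi_zero hα).csSup_eq, sub_self]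

lemma wishartPhi_le (hα : 1 ≤ α) (u : ℝ) {s : ℝ} (hs : s ∈ Ioo (0 : ℝ) 1) :
    wishartPhi α u s ≤ u ^ 2 / 4 + wishartPhi α 0 (α / (1 + α)) := by
  have h1 := (isGreatest_wishartPhi_zero hα).2 (mem_image_of_mem _ hs)
  have h2 : u ^ 2 * (s * (1 - s)) ≤ u ^ 2 / 4 := by
    nlinarith [mul_nonneg (sq_nonneg u) (sq_nonneg (1 - 2 * s))]
  have h3 : wishartPhi α u s = u ^ 2 * (s * (1 - s)) + wishartPhi α 0 s := by
    unfold wishartPhi; ring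
  linarith

/-- Above, use `s(1 - s) ≤ 1/4`; below, test with the maximiser for `u = 0`. This gives continuity
of `W` at `0` without the curve. -/
lemma abs_wishartW_le (hα : 1 ≤ α) (u : ℝ) : |wishartW α u| ≤ u ^ 2 / 4 := by
  have hne : (wishartPhi α u '' Ioo 0 1).Nonempty := ⟨_, mem_image_of_mem _ (ratio_mem_Ioo hα)⟩
  have hub : ∀ y ∈ wishartPhi α u '' Ioo 0 1, y ≤ u ^ 2 / 4 + wishartPhi α 0 (α / (1 + α)) := by
    rintro _ ⟨s, hs, rfl⟩
    exact wishartPhi_le hα u hs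
  have h1 := csSup_le hne hub
  have h2 := le_csSup ⟨_, hub⟩ (mem_image_of_mem _ (ratio_mem_Ioo hα))
  have h3 : wishartPhi α 0 (α / (1 + α)) ≤ wishartPhi α u (α / (1 + α)) := by
    have hr := ratio_mem_Ioo hα
    have : 0 ≤ u ^ 2 * (α / (1 + α) * (1 - α / (1 + α))) :=
      mul_nonneg (sq_nonneg u) (mul_nonneg hr.1.le (sub_nonneg.2 hr.2.le))
    unfold wishartPhi
    linarith
  rw [wishartW, abs_le]
  constructor <;> linarith [sq_nonneg u]

lemma continuousAt_wishartW (hα : 1 ≤ α) : ContinuousAt (wishartW α) 0 := by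
  rw [ContinuousAt, wishartW_zero hα, tendsto_zero_iff_norm_tendsto_zero]
  refine squeeze_zero (fun _ => norm_nonneg _) (fun u => abs_wishartW_le hα u) ?_
  have : Continuous fun u : ℝ => u ^ 2 / 4 := by fun_prop
  simpa using this.tendsto 0

/-- The constant `b C_α` is `b/2` times the maximum at `u = 0`, and the factor `b/2` comes out of
the supremum. -/
lemma wishartF_eq (hα : 1 ≤ α) {b : ℝ} (hb : 0 < b) (θ : ℝ) :
    wishartF α b θ = b / 2 * wishartW α (2 / b * θ) := by
  have h0 : 0 < 1 + α := by linarith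
  have e1 : (fun x : ℝ => 2 * θ ^ 2 / b * (x * (1 - x)) + b / (2 * (1 + α)) * Real.log (1 - x)
      + b * α / (2 * (1 + α)) * Real.log x) = fun x => (b / 2) • wishartPhi α (2 / b * θ) x := by
    funext x
    rw [wishartPhi, smul_eq_mul]
    field_simp
  have e2 : 1 - α / (1 + α) = 1 / (1 + α) := by field_simp; ring
  have e3 : b * wishartConst α = b / 2 * wishartPhi α 0 (α / (1 + α)) := by
    rw [wishartConst, wishartPhi, e2]
    field_simp
    ring
  rw [wishartF, wishartW, e1, e3, mul_sub, ← smul_eq_mul (b / 2) (sSup _),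
    ← Real.sSup_smul_of_nonneg (by positivity), ← image_smul, image_image]

/-! ### The spectral curve of `σ_w` -/

/-- The equation of the spectral curve of `σ_w`, on the part that carries both branches. -/
def OnWishartCurve (α z u : ℝ) : Prop :=
  z ^ 2 * u ^ 2 - 2 * z ^ 3 * u + 2 * z ^ 2 = ((α - 1) / (1 + α)) ^ 2 ∧ 1 < z * u

/-- The maximiser of `wishartPhi α u` when `(z, u)` is on the spectral curve. -/
noncomputable def wishartMax (α z u : ℝ) : ℝ := (1 + (α - 1) / (1 + α) / (z * u)) / 2

lemma wishartMax_mem_Ioo (hα : 1 ≤ α) {z u : ℝ} (hzu : 1 < z * u) :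
    wishartMax α z u ∈ Ioo (0 : ℝ) 1 := by
  have h0 : 0 < 1 + α := by linarith
  have hk0 : 0 ≤ (α - 1) / (1 + α) := div_nonneg (by linarith) h0.le
  have hk1 : (α - 1) / (1 + α) < 1 := by rw [div_lt_one h0]; linarith
  have h1 : 0 ≤ (α - 1) / (1 + α) / (z * u) := div_nonneg hk0 (by linarith)
  have h2 : (α - 1) / (1 + α) / (z * u) < 1 := by
    rw [div_lt_one (by linarith)]; linarith
  unfold wishartMax
  constructor <;> linarith

/-- This is `W'(u) = z - 1/u` in disguise: the `u`-derivative of `wishartPhi` is `2u s(1 - s)`. -/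
lemma OnWishartCurve.sq_mul_wishartMax {z u : ℝ} (hz : z ≠ 0) (h : OnWishartCurve α z u) :
    u ^ 2 * (wishartMax α z u * (1 - wishartMax α z u)) = (z * u - 1) / 2 := by
  obtain ⟨h, hzu⟩ := h
  have hu : u ≠ 0 := by rintro rfl; norm_num at hzu
  unfold wishartMax
  generalize (α - 1) / (1 + α) = k at h
  field_simp
  linear_combination h

/-- After clearing denominators the equation is cubic in `s`; replacing `u² s(1 - s)` by `(zu -
1)/2` makes it linear. -/
lemma OnWishartCurve.stationary (hα : 1 ≤ α) {z u : ℝ} (hz : z ≠ 0) (h : OnWishartCurve α z u) :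
    u ^ 2 * (1 - 2 * wishartMax α z u) - 1 / (1 + α) / (1 - wishartMax α z u)
      + α / (1 + α) / wishartMax α z u = 0 := by
  have hmem := wishartMax_mem_Ioo hα h.2
  have hp := h.sq_mul_wishartMax hz
  have hs : wishartMax α z u ≠ 0 := hmem.1.ne'
  have hs1 : 1 - wishartMax α z u ≠ 0 := (sub_pos.2 hmem.2).ne'
  have h0 : 1 + α ≠ 0 := by linarith
  have hzu : z * u ≠ 0 := by linarith [h.2]
  have hu : u ≠ 0 := right_ne_zero_of_mul hzu
  have hdef : (2 * wishartMax α z u - 1) * ((1 + α) * (z * u)) = α - 1 := by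
    unfold wishartMax
    field_simp
    ring
  generalize wishartMax α z u = s at *
  have key : u ^ 2 * (s * (1 - s)) * (1 - 2 * s) * (1 + α) - s + α * (1 - s) = 0 := by
    rw [hp]
    linear_combination (-1 / 2) * hdef
  field_simp
  linear_combination key

lemma OnWishartCurve.wishartW_eq (hα : 1 ≤ α) {z u : ℝ} (hz : z ≠ 0) (h : OnWishartCurve α z u) :
    wishartW α u = wishartPhi α u (wishartMax α z u) - wishartPhi α 0 (α / (1 + α)) :=
  LargestEigenvalue.wishartW_eq hα (wishartMax_mem_Ioo hα h.2) (h.stationary hα hz)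

lemma continuousOn_wishartW_branch (hα : 1 ≤ α) {r : ℝ} (hr : 0 < r) {u : ℝ → ℝ}
    (hu : ContinuousOn u (Ici r)) (h : ∀ z, r ≤ z → OnWishartCurve α z (u z)) :
    ContinuousOn (fun z => wishartW α (u z)) (Ici r) := by
  have hs : ContinuousOn (fun z => wishartMax α z (u z)) (Ici r) := by
    unfold wishartMax
    refine (continuousOn_const.add (continuousOn_const.div (continuousOn_id.mul hu) ?_)).div_const 2
    intro z hz
    have : z * u z ≠ 0 := by linarith [(h z hz).2]
    exact this
  have hphi : ContinuousOn (fun z => wishartPhi α (u z) (wishartMax α z (u z))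
      - wishartPhi α 0 (α / (1 + α))) (Ici r) := by
    unfold wishartPhi
    refine ContinuousOn.sub ?_ continuousOn_const
    refine ((((hu.pow 2).mul (hs.mul (continuousOn_const.sub hs))).add
      (continuousOn_const.mul ((continuousOn_const.sub hs).log ?_))).add
      (continuousOn_const.mul (hs.log ?_)))
    · exact fun z hz => (sub_pos.2 (wishartMax_mem_Ioo hα (h z hz).2).2).ne'
    · exact fun z hz => (wishartMax_mem_Ioo hα (h z hz).2).1.ne'
  exact hphi.congr fun z hz => (h z hz).wishartW_eq hα (hr.trans_le hz).ne'

/-- Envelope theorem: the motion of the maximiser contributes nothing by stationarity, so only the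
explicit dependence on `u` remains. -/
lemma hasDerivAt_wishartW_branch (hα : 1 ≤ α) {r : ℝ} (hr : 0 < r) {u : ℝ → ℝ} {u' z : ℝ}
    (hz : r < z) (hu : HasDerivAt u u' z) (h : ∀ z, r ≤ z → OnWishartCurve α z (u z)) :
    HasDerivAt (fun z => wishartW α (u z)) (u' * (z - 1 / u z)) z := by
  have hz0 : z ≠ 0 := (hr.trans hz).ne'
  have hc := h z hz.le
  have hzu : z * u z ≠ 0 := by linarith [hc.2]
  have hu0 : u z ≠ 0 := right_ne_zero_of_mul hzu
  have hmem := wishartMax_mem_Ioo hα hc.2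
  -- The value of `s'` is irrelevant, since its coefficient vanishes.
  obtain ⟨s', hs⟩ : ∃ s', HasDerivAt (fun z => wishartMax α z (u z)) s' z := by
    unfold wishartMax
    exact ⟨_, ((((hasDerivAt_const z ((α - 1) / (1 + α))).div
      ((hasDerivAt_id z).mul hu) hzu)).const_add 1).div_const 2⟩
  have hphi := ((((hu.pow 2).mul (hs.mul (hs.const_sub 1))).add
    (((hs.const_sub 1).log (sub_pos.2 hmem.2).ne').const_mul (1 / (1 + α)))).add
    ((hs.log hmem.1.ne').const_mul (α / (1 + α)))).sub_const (wishartPhi α 0 (α / (1 + α)))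
  have hev : (fun z => wishartW α (u z)) =ᶠ[𝓝 z] fun z =>
      wishartPhi α (u z) (wishartMax α z (u z)) - wishartPhi α 0 (α / (1 + α)) := by
    filter_upwards [Ioi_mem_nhds hz] with w hw
    exact (h w (le_of_lt hw)).wishartW_eq hα (hr.trans hw).ne'
  refine HasDerivAt.congr_of_eventuallyEq ?_ hev
  refine hphi.congr_deriv ?_
  have hstat := hc.stationary hα hz0
  have hp := hc.sq_mul_wishartMax hz0
  simp only [Pi.mul_apply, Pi.pow_apply]
  generalize wishartMax α z (u z) = s at *
  have e : u' * (z - 1 / u z) = 2 * u' / u z * (u z ^ 2 * (s * (1 - s))) := by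
    rw [hp]
    field_simp
  rw [e]
  have e2 : 2 * u' / u z * (u z ^ 2 * (s * (1 - s))) = 2 * u' * u z * (s * (1 - s)) := by
    field_simp
  rw [e2]
  linear_combination s' * hstat

/-! ### The gap function and the two Wishart branches. -/

lemma wishartGap_radicand_eq (hα : 1 ≤ α) (z : ℝ) :
    (1 + α) ^ 2 * (z ^ 2 - 1) ^ 2 - 4 * α =
      ((1 + α) * (z ^ 2 - 1) - 2 * √α) * ((1 + α) * (z ^ 2 - 1) + 2 * √α) := by
  have hss := Real.sq_sqrt (zero_le_one.trans hα)
  linear_combination 4 * hss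

lemma two_mul_sqrt_le (hα : 1 ≤ α) {z : ℝ} (hz : wishartEdge α ≤ z) :
    2 * √α ≤ (1 + α) * (z ^ 2 - 1) := by
  have h1 := wishartEdge_sq hα
  rw [mpUpper_eq hα] at h1
  have h2 : wishartEdge α ^ 2 ≤ z ^ 2 := pow_le_pow_left₀ (wishartEdge_pos hα).le hz 2
  nlinarith

lemma two_mul_sqrt_lt (hα : 1 ≤ α) {z : ℝ} (hz : wishartEdge α < z) :
    2 * √α < (1 + α) * (z ^ 2 - 1) := by
  have h1 := wishartEdge_sq hα
  rw [mpUpper_eq hα] at h1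
  have h2 : wishartEdge α ^ 2 < z ^ 2 := pow_lt_pow_left₀ hz (wishartEdge_pos hα).le two_ne_zero
  nlinarith

lemma one_lt_of_wishartEdge_le (hα : 1 ≤ α) {z : ℝ} (hz : wishartEdge α ≤ z) : 1 < z ^ 2 := by
  have h1 := two_mul_sqrt_le hα hz
  have h2 : 0 < √α := Real.sqrt_pos.2 (by linarith)
  have h3 : 0 < (1 + α) * (z ^ 2 - 1) := by linarith
  linarith [(mul_pos_iff_of_pos_left (by linarith : 0 < 1 + α)).1 h3]

lemma radicand_nonneg (hα : 1 ≤ α) {z : ℝ} (hz : wishartEdge α ≤ z) :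
    0 ≤ (1 + α) ^ 2 * (z ^ 2 - 1) ^ 2 - 4 * α := by
  have h1 := two_mul_sqrt_le hα hz
  rw [wishartGap_radicand_eq hα]
  exact mul_nonneg (by linarith) (by linarith [Real.sqrt_nonneg α])

lemma radicand_pos (hα : 1 ≤ α) {z : ℝ} (hz : wishartEdge α < z) :
    0 < (1 + α) ^ 2 * (z ^ 2 - 1) ^ 2 - 4 * α := by
  have h1 := two_mul_sqrt_lt hα hz
  rw [wishartGap_radicand_eq hα]
  exact mul_pos (by linarith) (by linarith [Real.sqrt_nonneg α])

lemma wishartGap_nonneg (hα : 1 ≤ α) {z : ℝ} (hz : wishartEdge α ≤ z) : 0 ≤ wishartGap α z :=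
  div_nonneg (Real.sqrt_nonneg _)
    (mul_nonneg (by linarith) ((wishartEdge_pos hα).le.trans hz))

lemma wishartGap_edge (hα : 1 ≤ α) : wishartGap α (wishartEdge α) = 0 := by
  have h1 := wishartEdge_sq hα
  rw [mpUpper_eq hα] at h1
  have : (1 + α) * (wishartEdge α ^ 2 - 1) - 2 * √α = 0 := by linarith
  rw [wishartGap, wishartGap_radicand_eq hα, this]
  simp

/-- Completing the square, the curve equation prescribes `z²(u - z)²`; this identity puts both `z ±
wishartGap α z` on it. -/
lemma wishartGap_sq (hα : 1 ≤ α) {z : ℝ} (hz : wishartEdge α ≤ z) :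
    z ^ 2 * wishartGap α z ^ 2 = z ^ 4 - 2 * z ^ 2 + ((α - 1) / (1 + α)) ^ 2 := by
  have hz0 : z ≠ 0 := ((wishartEdge_pos hα).trans_le hz).ne'
  have h0 : 1 + α ≠ 0 := by linarith
  rw [wishartGap, div_pow, Real.sq_sqrt (radicand_nonneg hα hz)]
  field_simp
  ring

lemma onWishartCurve_lower (hα : 1 ≤ α) {z : ℝ} (hz : wishartEdge α ≤ z) :
    OnWishartCurve α z (z - wishartGap α z) := by
  have h1 := wishartGap_sq hα hz
  refine ⟨by linear_combination h1, ?_⟩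
  have hz0 : 0 < z := (wishartEdge_pos hα).trans_le hz
  have h0 : 0 < 1 + α := by linarith
  have hz1 := one_lt_of_wishartEdge_le hα hz
  -- Dropping `-4α < 0` gives `z · gap < z² - 1`, which is `1 < zu` on the lower branch.
  have h2 : √((1 + α) ^ 2 * (z ^ 2 - 1) ^ 2 - 4 * α) < (1 + α) * (z ^ 2 - 1) := by
    rw [Real.sqrt_lt' (mul_pos h0 (by linarith))]
    nlinarith
  have h3 : z * wishartGap α z = √((1 + α) ^ 2 * (z ^ 2 - 1) ^ 2 - 4 * α) / (1 + α) := by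
    rw [wishartGap]; field_simp
  have h4 : z * wishartGap α z < z ^ 2 - 1 := by
    rw [h3, div_lt_iff₀ h0]; linarith
  nlinarith

lemma onWishartCurve_upper (hα : 1 ≤ α) {z : ℝ} (hz : wishartEdge α ≤ z) :
    OnWishartCurve α z (z + wishartGap α z) := by
  have h1 := wishartGap_sq hα hz
  refine ⟨by linear_combination h1, ?_⟩
  have hz0 : 0 < z := (wishartEdge_pos hα).trans_le hz
  have hz1 := one_lt_of_wishartEdge_le hα hz
  nlinarith [mul_nonneg hz0.le (wishartGap_nonneg hα hz)]

lemma continuousOn_wishartGap (hα : 1 ≤ α) : ContinuousOn (wishartGap α) (Ici (wishartEdge α)) := by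
  unfold wishartGap
  refine ContinuousOn.div (by fun_prop) (by fun_prop) fun z hz => ?_
  have hz0 : 0 < z := (wishartEdge_pos hα).trans_le hz
  positivity

lemma hasDerivAt_wishartGap (hα : 1 ≤ α) {z : ℝ} (hz : wishartEdge α < z) :
    ∃ d, 0 ≤ d ∧ HasDerivAt (wishartGap α) d z := by
  have hz0 : 0 < z := (wishartEdge_pos hα).trans hz
  have h0 : 0 < 1 + α := by linarith
  have hz1 := one_lt_of_wishartEdge_le hα hz.le
  have hrad := radicand_pos hα hz
  have hS : 0 < √((1 + α) ^ 2 * (z ^ 2 - 1) ^ 2 - 4 * α) := Real.sqrt_pos.2 hrad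
  have hSS := Real.sq_sqrt hrad.le
  have d1 : HasDerivAt (fun z : ℝ => (1 + α) ^ 2 * (z ^ 2 - 1) ^ 2 - 4 * α)
      (4 * (1 + α) ^ 2 * z * (z ^ 2 - 1)) z := by
    refine (((((hasDerivAt_pow 2 z).sub_const 1).pow 2).const_mul
      ((1 + α) ^ 2)).sub_const (4 * α)).congr_deriv ?_
    norm_num
    ring
  have d2 := (d1.sqrt hrad.ne').div ((hasDerivAt_id z).const_mul (1 + α)) (by
    simp only [id]; positivity)
  -- Quotient rule with the square root cleared from the numerator; in this form the sign is visible
  -- from `z² > 1`.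
  refine ⟨((1 + α) ^ 2 * (z ^ 4 - 1) + 4 * α) /
    ((1 + α) * z ^ 2 * √((1 + α) ^ 2 * (z ^ 2 - 1) ^ 2 - 4 * α)), ?_, d2.congr_deriv ?_⟩
  · have : 0 ≤ z ^ 4 - 1 := by nlinarith
    positivity
  · simp only [id]
    generalize √((1 + α) ^ 2 * (z ^ 2 - 1) ^ 2 - 4 * α) = S at *
    field_simp
    linear_combination (-2) * hSS

/-- The spectral curve of `σ_w`. -/
theorem isSpectralCurve_wishartLaw (hα : 1 ≤ α) :
    IsSpectralCurve (wishartLaw α) (wishartEdge α) (fun z => z - wishartGap α z)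
      (fun z => z + wishartGap α z) (wishartW α) where
  pos := wishartEdge_pos hα
  ae_mem := ae_mem_wishartLaw hα
  mem_support := wishartEdge_mem_support hα
  stieltjes_eq := fun _ hz => stieltjes_wishartLaw hα hz
  continuousOn_lower := continuousOn_id.sub (continuousOn_wishartGap hα)
  continuousOn_upper := continuousOn_id.add (continuousOn_wishartGap hα)
  edge_eq := by rw [wishartGap_edge hα]; ring
  tendsto_upper := by
    refine tendsto_atTop_mono' _ ?_ tendsto_id
    filter_upwards [eventually_ge_atTop (wishartEdge α)] with z hz
    simp only [id]
    linarith [wishartGap_nonneg hα hz]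
  W_zero := wishartW_zero hα
  continuousAt_W := continuousAt_wishartW hα
  continuousOn_W_lower := continuousOn_wishartW_branch hα (wishartEdge_pos hα)
    (continuousOn_id.sub (continuousOn_wishartGap hα)) fun _ hz => onWishartCurve_lower hα hz
  continuousOn_W_upper := continuousOn_wishartW_branch hα (wishartEdge_pos hα)
    (continuousOn_id.add (continuousOn_wishartGap hα)) fun _ hz => onWishartCurve_upper hα hz
  lower_deriv := fun z hz => by
    obtain ⟨d, -, hd⟩ := hasDerivAt_wishartGap hα hz
    have hu := (hasDerivAt_id z).sub hd
    exact ⟨_, hu, hasDerivAt_wishartW_branch hα (wishartEdge_pos hα) hz hu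
      fun _ hz => onWishartCurve_lower hα hz⟩
  upper_deriv := fun z hz => by
    obtain ⟨d, hd0, hd⟩ := hasDerivAt_wishartGap hα hz
    have hu := (hasDerivAt_id z).add hd
    exact ⟨_, by linarith, hu, hasDerivAt_wishartW_branch hα (wishartEdge_pos hα) hz hu
      fun _ hz => onWishartCurve_upper hα hz⟩

theorem wishartRate_eq_iSup (hα : 1 ≤ α) {b x : ℝ} (hb : 0 < b)
    (hx : rightEdge (wishartLaw α) ≤ x) :
    wishartRate α b x = ⨆ θ : {θ : ℝ // 0 ≤ θ},
      ((sphericalLimit b (wishartLaw α) θ x - wishartF α b θ : ℝ) : EReal) := by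
  have := isProbabilityMeasure_wishartLaw hα
  have H := isSpectralCurve_wishartLaw hα
  rw [H.rightEdge_eq] at hx
  simp only [wishartF_eq hα hb]
  rw [H.iSup_sphericalLimit_sub hb hx, wishartRate, if_neg (not_lt.2 hx),
    ← intervalIntegral.integral_const_mul, ← intervalIntegral.integral_const_mul]
  congr 2
  funext y
  have h0 : 1 + α ≠ 0 := by linarith
  rw [wishartGap, one_div, div_eq_mul_inv (√_), mul_inv]
  field_simp
  ring

end WishartVariational

end LargestEigenvalue

theorem mainTheorem9 (α : ℝ) (hα : 1 ≤ α) (m : Model) (x : ℝ)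
    (hx : rightEdge (limitLaw α m) ≤ x) :
    rate α x m =
      ⨆ θ : {θ : ℝ // 0 ≤ θ},
        ((sphericalLimit m.beta (limitLaw α m) θ x - Ffun α θ m : ℝ) : EReal) := by
  cases m with
  | wignerReal => exact wignerRate_eq_iSup one_pos hx
  | wignerComplex => exact wignerRate_eq_iSup two_pos hx
  | wishartReal => exact wishartRate_eq_iSup hα one_pos hx
  | wishartComplex => exact wishartRate_eq_iSup hα two_pos hx
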